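/- **Conventions.** A graph $X$ (in the sense of Serre) has oriented edges $e$ with reversal $\bar e\ne e$, origin $o(e)=t(\bar e)$ and terminal vertex $t(e)$. A graph of groups $\mathbb X$ on $X$ has vertex groups $\Gamma_v$, edge groups $\Gamma_e=\Gamma_{\bar e}$ and injections $i_e:\Gamma_e\to\Gamma_{t(e)}$. Its Bass group is $$B(\mathbb X)=\Big\langle \textstyle\bigcup_v\Gamma_v\cup E \;\Big|\; \bar e=e^{-1},\ e^{-1}i_{\bar e}(g)e=i_e(g)\Big\rangle ,$$ $\pi_1(\mathbb X,v_0)\le B(\mathbb X)$ is the subgroup of path elements from $v_0$ to $v_0$, and $\pi_1(\mathbb X,\tau)=B(\mathbb X)/\langle\langle e\in\tau\rangle\rangle$ for a maximal subtree $\tau$; the quotient map restricts to an isomorphism $\pi_1(\mathbb X,v_0)\to\pi_1(\mathbb X,\tau)$. For $x\in B(\mathbb X)$, $n(x,e)\in\mathbb Z$ is the number of occurrences of $e$ minus that of $\bar e$. An isomorphism of graphs of groups $\Phi:\mathbb X\to\mathbb X'$ is a tuple $(\Phi_X,(\phi_v),(\phi_e),(\gamma_e))$ consisting of a graph isomorphism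 $\Phi_X$, isomorphisms $\phi_v:\Gamma_v\to\Gamma_{\Phi_X(v)}$ and $\phi_e=\phi_{\bar e}:\Gamma_e\to\Gamma_{\Phi_X(e)}$, and elements $\gamma_e\in\Gamma_{\Phi_X(t(e))}$ with $\phi_{t(e)}(i_e(g))=\gamma_e^{-1}\, i_{\Phi_X(e)}(\phi_e(g))\,\gamma_e$. It induces $B(\mathbb X)\to B(\mathbb X')$ by $\phi_v$ on $\Gamma_v$ and $e\mapsto\gamma_{\bar e}^{-1}\Phi_X(e)\gamma_e$, hence an isomorphism of fundamental groups $\pi_1(\mathbb X,v_0)\to\pi_1(\mathbb X',\Phi_X(v_0))$. **Suspensions.** Let $F$ be a free group of finite rank with basis $(f_i)$, let $\phi_1,\phi_2\in\mathrm{Aut}(F)$, and $G_k=F\rtimes_{\phi_k}\langle t\rangle$ with $t^{-1}ft=\phi_k(f)$. Let $\delta:G_k\to\mathbb Z$ be the homomorphism with kernel $F$ (the fiber) and $\delta(t)=1$. For a subgroup $\Gamma$ of $G_k$ (such as a vertex group) with $\delta(\Gamma)\neq0$, the fiber is $\Gamma\cap F$ and the orientation is the coset of those $s\in\Gamma$ for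 which $\delta(s)>0$ generates $\delta(\Gamma)$. An isomorphism is *fiber and orientation preserving* if it maps fiber onto fiber and orientation into orientation. A subgroup of $\Gamma\cap F$ is *polynomial* if for each of its elements $f$ the length of a cyclically reduced representative of $s^{-n}fs^n$, on a finite basis of $\Gamma\cap F$, is bounded by a polynomial in $n\ge 0$, where $s$ is in the orientation of $\Gamma$. For an integer $m\ge0$, $K_m(\Gamma)$ is the normal closure in $\Gamma$ of the union, over the maximal polynomial subgroups $P$ of $\Gamma\cap F$, of the intersections of all subgroups of $P$ of index at most $m$ in $P$ (the intersection being $P$ if $m=0$). **Data.** Let $\mathbb X_1,\mathbb X_2$ be graph-of-groups decompositions of $G_1,G_2$ over cyclic subgroups, $\Phi_X:X_1\to X_2$ an isomorphism of the underlying graphs, $\tau$ a maximal subtree of $X_1$; identify $G_1=\pi_1(\mathbb X_1,\tau)$ and $G_2=\pi_1(\mathbb X_2,\Phi_X(\tau))$. In both decompositions let $c_e=c_{\bar e}$ be the generator of $\Gamma_e$ with $\delta(c_e)>0$ (any generator, if $\delta$ vanishes on $\Gamma_e$), and equip each vertex group $\Gamma_v$ with the peripheral structure consisting of the tuple of elements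 $i_e(c_e)$, $t(e)=v$. Let $m\ge0$ be an integer and, for every vertex $v$ of $X_1$, let $\mathcal L_v$ be a finite list of isomorphisms $\Gamma_v\to\Gamma_{\Phi_X(v)}$ such that: * the peripheral structures of $\Gamma_v$ and $\Gamma_{\Phi_X(v)}$ are transverse, i.e. $\delta(i_e(c_e))\ne0$ for all their members; * each $\phi\in\mathcal L_v$ preserves fiber, orientation and peripheral structure, the last meaning that $\phi(i_e(c_e))$ is conjugate in $\Gamma_{\Phi_X(v)}$ to $i_{\Phi_X(e)}(c_{\Phi_X(e)})$ for each $e$ with $t(e)=v$; * for each member $p$ of the peripheral structure of $\Gamma_{\Phi_X(v)}$, the centralizer of $\bar p$ in $\Gamma_{\Phi_X(v)}/K_m(\Gamma_{\Phi_X(v)})$ is the image of the centralizer of $p$ in $\Gamma_{\Phi_X(v)}$; * for each isomorphism $\psi:\Gamma_v\to\Gamma_{\Phi_X(v)}$ preserving fiber, orientation and peripheral structure there are $\phi\in\mathcal L_v$ and $g\in\Gamma_{\Phi_X(v)}$ such that for all $h\in\Gamma_v$, $g^{-1}\psi(h)g=\phi(h)z_h$ for some $z_h\in K_m(\Gamma_{\Phi_X(v)})$.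 Let $E^+$ be a set of representatives of the unoriented edges of $X_2$, and for each $e\in E^+$ let $S_e$ be a generating set of the centralizer of $i_e(\Gamma_e)$ in $\Gamma_{t(e)}$. Let $v_0$ be a vertex of $X_1$, and let $x_i$ and $x_t$ be the elements of $\pi_1(\mathbb X_1,v_0)$ corresponding to $f_i$ and $t$. For an isomorphism of graphs of groups $\Phi_0:\mathbb X_1\to\mathbb X_2$ over $\Phi_X$, put $\gamma_i=\Phi_0(x_i)$ and $\gamma_t=\Phi_0(x_t)$, and let $(\ast)_{\Phi_0}$ be the linear Diophantine system in the unknowns $r_s\in\mathbb Z$ ($e\in E^+$, $s\in S_e$; almost all zero) $$\sum_{e\in E^+,\ s\in S_e} r_s\, n(\gamma_j,e)\,\delta(s) = -\delta(\gamma_j)+\mathrm{dirac}_{j=t},$$ with one equation for each index $j$ ($j=i$ or $j=t$). **Proposition.** The following are equivalent. 1. There is an isomorphism $\Phi:\pi_1(\mathbb X_1,\tau)\to\pi_1(\mathbb X_2,\Phi_X(\tau))$ that is fiber and orientation preserving and that is, up to an inner automorphism, induced by an isomorphism of graphs of groups over $\Phi_X$. 2. There is an isomorphism of graphs of groups $\Phi_0=(\Phi_X,(\phi_v),(\phi_e),(\gamma_e))$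 such that every $\phi_v$ is fiber and orientation preserving and $(\ast)_{\Phi_0}$ has a solution. 3. There is an isomorphism of graphs of groups $\Phi_0'=(\Phi_X,(\phi'_v),(\phi'_e),(\gamma'_e))$ such that $\phi'_v\in\mathcal L_v$ for every vertex $v$ and $(\ast)_{\Phi_0'}$ has a solution. -/

import Mathlib

/-! Suspensions, transverse structures, Dehn-filling kernels -/

/-- The suspension `F ⋊_φ ⟨t⟩`, with the convention `t⁻¹ f t = φ f` for `f` in the fiber `F`. -/
abbrev Suspension {F : Type*} [Group F] (φ : MulAut F) : Type _ :=
  F ⋊[zpowersHom (MulAut F) φ⁻¹] Multiplicative ℤ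

namespace Suspension

variable {F : Type*} [Group F]

/-- The element `f` of the fiber. -/
def fib (φ : MulAut F) (f : F) : Suspension φ := SemidirectProduct.inl f

/-- The transverse element `t`. -/
def stable (φ : MulAut F) : Suspension φ := SemidirectProduct.inr (Multiplicative.ofAdd 1)

/-- The quotient map `F ⋊_φ ⟨t⟩ → ⟨t⟩ = ℤ`, whose kernel is the fiber; it sends `f * t ^ k`
to `k`. -/
def height (φ : MulAut F) : Suspension φ →* Multiplicative ℤ := SemidirectProduct.rightHom

end Suspension

/-! For a group `Γ` with a homomorphism `δ : Γ → ℤ` (for instance a subgroup of a suspension, with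
the restriction of `height`), the fiber of `Γ` is `δ.ker`. When `δ` is not trivial, `Γ` is the
suspension of its fiber, oriented by `δ`. -/

/-- `t` lies in the orientation coset `t_Γ * δ.ker` of `Γ = δ.ker ⋊ ⟨t_Γ⟩`: it is positive and its
height generates the image of `δ`. -/
def IsTransverse {Γ : Type*} [Group Γ] (δ : Γ →* Multiplicative ℤ) (t : Γ) : Prop :=
  0 < (δ t).toAdd ∧ ∀ g, (δ t).toAdd ∣ (δ g).toAdd

/-- The isomorphism `φ` maps fiber onto fiber and orientation coset into orientation coset. -/
def FiberOrientationPreserving {Γ₁ Γ₂ : Type*} [Group Γ₁] [Group Γ₂]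
    (δ₁ : Γ₁ →* Multiplicative ℤ) (δ₂ : Γ₂ →* Multiplicative ℤ) (φ : Γ₁ ≃* Γ₂) : Prop :=
  δ₁.ker.map φ.toMonoidHom = δ₂.ker ∧ ∀ t, IsTransverse δ₁ t → IsTransverse δ₂ (φ t)

/-- The length of a cyclically reduced representative of `g` on the basis `b`. -/
def cyclicLength {H : Type*} [Group H] {k : ℕ} (b : FreeGroupBasis (Fin k) H) (g : H) : ℕ :=
  (FreeGroup.reduceCyclically (b.repr g).toWord).length

/-- The conjugacy class of the fiber element `f` grows at most polynomially under the iterates of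
the automorphism `x ↦ t⁻¹ x t` of the fiber, where `t` is a transverse element. -/
def IsPolynomialElement {Γ : Type*} [Group Γ] (δ : Γ →* Multiplicative ℤ) (f : δ.ker) : Prop :=
  ∃ t : Γ, IsTransverse δ t ∧ ∃ (k : ℕ) (b : FreeGroupBasis (Fin k) δ.ker) (P : Polynomial ℕ),
    ∀ n : ℕ, cyclicLength b ((MulAut.conjNormal t⁻¹ ^ n : MulAut δ.ker) f) ≤ P.eval n

/-- A subgroup of the fiber is polynomial if all its elements are. -/
def IsPolynomialSubgroup {Γ : Type*} [Group Γ] (δ : Γ →* Multiplicative ℤ)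
    (P : Subgroup δ.ker) : Prop :=
  ∀ f ∈ P, IsPolynomialElement δ f

/-- The intersection of all the subgroups of `P` of (finite) index at most `m` in `P`. -/
def indexCore {H : Type*} [Group H] (P : Subgroup H) (m : ℕ) : Subgroup H :=
  P ⊓ sInf {Q : Subgroup H | Q ≤ P ∧ Q.relIndex P ≠ 0 ∧ Q.relIndex P ≤ m}

/-- The Dehn-filling kernel `K_m`: the normal closure in `Γ` of the union of the groups
`indexCore P m`, for `P` ranging over the maximal polynomial subgroups of the fiber (these are the
intersections with the fiber of the maximal parabolic subgroups; taking all of them rather than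
conjugacy representatives does not change the normal closure). -/
def fillingKernel {Γ : Type*} [Group Γ] (δ : Γ →* Multiplicative ℤ) (m : ℕ) : Subgroup Γ :=
  Subgroup.normalClosure
    {x | ∃ P : Subgroup δ.ker, Maximal (IsPolynomialSubgroup δ) P ∧
      ∃ y ∈ indexCore P m, (y : Γ) = x}

instance fillingKernel_normal {Γ : Type*} [Group Γ] (δ : Γ →* Multiplicative ℤ) (m : ℕ) :
    (fillingKernel δ m).Normal :=
  Subgroup.normalClosure_normal

/-- A transverse cyclic peripheral structure: a tuple of elements outside the fiber. -/
def IsTransversePeripheral {Γ : Type*} [Group Γ] (δ : Γ →* Multiplicative ℤ) {J : Type*}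
    (p : J → Γ) : Prop :=
  ∀ j, (δ (p j)).toAdd ≠ 0

/-- `φ` preserves fiber, orientation, and the peripheral structure (a tuple of conjugacy
classes). -/
def PreservesSuspensionStructure {Γ₁ Γ₂ : Type*} [Group Γ₁] [Group Γ₂]
    (δ₁ : Γ₁ →* Multiplicative ℤ) (δ₂ : Γ₂ →* Multiplicative ℤ) {J : Type*}
    (p₁ : J → Γ₁) (p₂ : J → Γ₂) (φ : Γ₁ ≃* Γ₂) : Prop :=
  FiberOrientationPreserving δ₁ δ₂ φ ∧ ∀ j, IsConj (φ (p₁ j)) (p₂ j)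

/-- `L` is a list of isomorphisms between the suspensions `Γ₁` and `Γ₂`, equipped with transverse
cyclic peripheral structures `p₁` and `p₂`, that contains all structure-preserving isomorphisms up
to conjugation and multiplication by elements of `K_m`, where `m` is such that centralizers of
peripheral elements of `Γ₂ ⧸ K_m` lift. -/
structure IsCompleteList {Γ₁ Γ₂ : Type*} [Group Γ₁] [Group Γ₂]
    (δ₁ : Γ₁ →* Multiplicative ℤ) (δ₂ : Γ₂ →* Multiplicative ℤ) {J : Type*}
    (p₁ : J → Γ₁) (p₂ : J → Γ₂) (m : ℕ) (L : List (Γ₁ ≃* Γ₂)) : Prop where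
  transverse₁ : IsTransversePeripheral δ₁ p₁
  transverse₂ : IsTransversePeripheral δ₂ p₂
  preserves : ∀ φ ∈ L, PreservesSuspensionStructure δ₁ δ₂ p₁ p₂ φ
  centralizer : ∀ j,
    Subgroup.centralizer {QuotientGroup.mk' (fillingKernel δ₂ m) (p₂ j)} =
      (Subgroup.centralizer {p₂ j}).map (QuotientGroup.mk' (fillingKernel δ₂ m))
  complete : ∀ ψ : Γ₁ ≃* Γ₂, PreservesSuspensionStructure δ₁ δ₂ p₁ p₂ ψ →
    ∃ φ ∈ L, ∃ g : Γ₂, ∀ h : Γ₁, ∃ z ∈ fillingKernel δ₂ m, g⁻¹ * ψ h * g = φ h * z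

/-! Graphs -/

set_option linter.checkUnivs false

/-- A graph in the sense of Serre. -/
structure SerreGraph where
  V : Type*
  E : Type*
  bar : E → E
  t : E → V
  bar_bar : ∀ e, bar (bar e) = e
  bar_ne : ∀ e, bar e ≠ e

namespace SerreGraph

/-- The origin of an oriented edge. -/
abbrev o (X : SerreGraph) (e : X.E) : X.V := X.t (X.bar e)

/-- The set of unoriented edges `{e, bar e}`. -/
def UEdge (X : SerreGraph) : Type _ := Quot fun a b : X.E => b = X.bar a

/-- The unoriented edge of an oriented edge. -/
def und (X : SerreGraph) (e : X.E) : X.UEdge := Quot.mk _ e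

theorem und_bar (X : SerreGraph) (e : X.E) : X.und (X.bar e) = X.und e :=
  (Quot.sound (r := fun a b : X.E => b = X.bar a) rfl).symm

/-- The list `l` of oriented edges is an edge path from `v` to `w`. -/
def IsEdgePath (X : SerreGraph) : X.V → List X.E → X.V → Prop
  | v, [], w => v = w
  | v, e :: l, w => X.o e = v ∧ X.IsEdgePath (X.t e) l w

/-- `τ` is (the set of oriented edges of) a maximal subtree of `X`: it is stable under reversal and
any two vertices of `X` are joined by exactly one reduced edge path in `τ`. -/
def IsMaximalSubtree (X : SerreGraph) (τ : Set X.E) : Prop :=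
  (∀ e ∈ τ, X.bar e ∈ τ) ∧
    ∀ v w, ∃! l : List X.E,
      X.IsEdgePath v l w ∧ (∀ e ∈ l, e ∈ τ) ∧ l.IsChain (fun a b => b ≠ X.bar a)

/-- `P` is a set of representatives of the unoriented edges. -/
def IsOrientation (X : SerreGraph) (P : Set X.E) : Prop :=
  ∀ e, Xor (e ∈ P) (X.bar e ∈ P)

/-- An isomorphism of graphs. -/
structure Iso (X Y : SerreGraph) where
  onV : X.V ≃ Y.V
  onE : X.E ≃ Y.E
  map_bar : ∀ e, onE (X.bar e) = Y.bar (onE e)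
  map_t : ∀ e, Y.t (onE e) = onV (X.t e)

/-- The map induced on unoriented edges. -/
def Iso.onU {X Y : SerreGraph} (Φ : X.Iso Y) : X.UEdge → Y.UEdge :=
  Quot.map Φ.onE (by rintro a b rfl; exact Φ.map_bar a)

theorem Iso.und_onE {X Y : SerreGraph} (Φ : X.Iso Y) (e : X.E) :
    Y.und (Φ.onE e) = Φ.onU (X.und e) := rfl

end SerreGraph

/-! Graphs of groups -/

/-- A graph of groups on `X`: a group for each vertex and for each unoriented edge, and for each
oriented edge `e` an injective homomorphism `i_e` from the group of the unoriented edge of `e` to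
that of the terminal vertex of `e`. The equalities in the arguments of `inc` only serve to avoid
transports. -/
structure GraphOfGroups (X : SerreGraph) where
  VG : X.V → Type*
  EG : X.UEdge → Type*
  [groupV : ∀ v, Group (VG v)]
  [groupE : ∀ u, Group (EG u)]
  inc : ∀ (e : X.E) {u : X.UEdge} {v : X.V}, X.und e = u → X.t e = v → (EG u →* VG v)
  inc_injective : ∀ (e : X.E) {u : X.UEdge} {v : X.V} (hu : X.und e = u) (hv : X.t e = v),
    Function.Injective (inc e hu hv)

attribute [instance] GraphOfGroups.groupV GraphOfGroups.groupE

namespace GraphOfGroups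

variable {X : SerreGraph} (𝕏 : GraphOfGroups X)

/-- Generators of the Bass group: the elements of the vertex groups and the oriented edges. -/
abbrev BassGen : Type _ := (Σ v, 𝕏.VG v) ⊕ X.E

/-- The generator attached to an element of a vertex group. -/
def genV (v : X.V) (g : 𝕏.VG v) : FreeGroup 𝕏.BassGen := FreeGroup.of (Sum.inl ⟨v, g⟩)

/-- The generator attached to an oriented edge. -/
def genE (e : X.E) : FreeGroup 𝕏.BassGen := FreeGroup.of (Sum.inr e)

/-- The relators of the Bass group: those of the vertex groups, `bar e = e⁻¹`, and
`e⁻¹ i_{bar e}(g) e = i_e(g)`. -/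
inductive BassRel : FreeGroup 𝕏.BassGen → Prop
  | vertex (v : X.V) (g h : 𝕏.VG v) :
      BassRel (𝕏.genV v g * 𝕏.genV v h * (𝕏.genV v (g * h))⁻¹)
  | bar (e : X.E) : BassRel (𝕏.genE e * 𝕏.genE (X.bar e))
  | edge (e : X.E) (g : 𝕏.EG (X.und e)) :
      BassRel ((𝕏.genE e)⁻¹ * 𝕏.genV (X.o e) (𝕏.inc (X.bar e) (X.und_bar e) rfl g) * 𝕏.genE e *
        (𝕏.genV (X.t e) (𝕏.inc e rfl rfl g))⁻¹)

/-- The Bass group `B(𝕏)`. -/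
abbrev Bass : Type _ := PresentedGroup {r | 𝕏.BassRel r}

/-- The vertex groups in the Bass group. -/
def vert (v : X.V) : 𝕏.VG v →* 𝕏.Bass :=
  MonoidHom.mk' (fun g => PresentedGroup.of (Sum.inl ⟨v, g⟩)) fun g h => by
    have := PresentedGroup.one_of_mem (rels := {r | 𝕏.BassRel r}) (BassRel.vertex v g h)
    rw [map_mul, map_mul, map_inv, mul_inv_eq_one] at this
    exact this.symm

/-- The oriented edges in the Bass group. -/
def edge (e : X.E) : 𝕏.Bass := PresentedGroup.of (Sum.inr e)

theorem edge_bar (e : X.E) : 𝕏.edge (X.bar e) = (𝕏.edge e)⁻¹ := by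
  have := PresentedGroup.one_of_mem (rels := {r | 𝕏.BassRel r}) (BassRel.bar e)
  rw [map_mul] at this
  exact eq_inv_of_mul_eq_one_right this

/-- Path elements `g₀ e₁ g₁ ⋯ eₙ gₙ` from `v` to `w`. -/
inductive IsPathElement : X.V → X.V → 𝕏.Bass → Prop
  | vertex (v : X.V) (g : 𝕏.VG v) : IsPathElement v v (𝕏.vert v g)
  | cons (e : X.E) (g : 𝕏.VG (X.o e)) (w : X.V) (x : 𝕏.Bass) :
      IsPathElement (X.t e) w x → IsPathElement (X.o e) w (𝕏.vert (X.o e) g * 𝕏.edge e * x)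

theorem IsPathElement.mul_vert {v w : X.V} {x : 𝕏.Bass} (h : 𝕏.IsPathElement v w x)
    (g : 𝕏.VG v) : 𝕏.IsPathElement v w (𝕏.vert v g * x) := by
  cases h with
  | vertex v k => rw [← map_mul]; exact .vertex _ _
  | cons e k w x hx =>
    have := IsPathElement.cons e (g * k) w x hx
    rwa [map_mul, mul_assoc, mul_assoc, ← mul_assoc (𝕏.vert _ k)] at this

theorem IsPathElement.mul {u v w : X.V} {x y : 𝕏.Bass} (hx : 𝕏.IsPathElement u v x)
    (hy : 𝕏.IsPathElement v w y) : 𝕏.IsPathElement u w (x * y) := by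
  induction hx with
  | vertex v g => exact hy.mul_vert 𝕏 g
  | cons e g v x _ ih =>
    rw [mul_assoc]
    exact .cons e g w _ (ih hy)

theorem IsPathElement.edge (e : X.E) : 𝕏.IsPathElement (X.o e) (X.t e) (𝕏.edge e) := by
  have := IsPathElement.cons e 1 _ _ (IsPathElement.vertex (𝕏 := 𝕏) (X.t e) 1)
  simpa using this

theorem IsPathElement.edge_inv (e : X.E) :
    𝕏.IsPathElement (X.t e) (X.o e) (𝕏.edge e)⁻¹ := by
  have := IsPathElement.edge 𝕏 (X.bar e)
  rwa [𝕏.edge_bar, SerreGraph.o, X.bar_bar] at this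

theorem IsPathElement.inv {u v : X.V} {x : 𝕏.Bass} (hx : 𝕏.IsPathElement u v x) :
    𝕏.IsPathElement v u x⁻¹ := by
  induction hx with
  | vertex v g => rw [← map_inv]; exact .vertex _ _
  | cons e g v x _ ih =>
    rw [mul_inv_rev, mul_inv_rev, ← map_inv]
    exact ih.mul 𝕏 ((IsPathElement.edge_inv 𝕏 e).mul 𝕏 (.vertex _ _))

/-- The fundamental group `π₁(𝕏, v₀)` of path elements from `v₀` to `v₀`. -/
def FundVertex (v₀ : X.V) : Subgroup 𝕏.Bass where
  carrier := {x | 𝕏.IsPathElement v₀ v₀ x}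
  mul_mem' := fun hx hy => hx.mul 𝕏 hy
  one_mem' := by
    have := IsPathElement.vertex (𝕏 := 𝕏) v₀ 1
    rwa [map_one] at this
  inv_mem' := fun hx => hx.inv 𝕏

/-- The fundamental group `π₁(𝕏, τ) = B(𝕏) / ⟨⟨e ∈ τ⟩⟩`. -/
abbrev FundTree (τ : Set X.E) : Type _ := 𝕏.Bass ⧸ Subgroup.normalClosure (𝕏.edge '' τ)

/-- The quotient map `B(𝕏) → π₁(𝕏, τ)`. -/
def toFundTree (τ : Set X.E) : 𝕏.Bass →* 𝕏.FundTree τ := QuotientGroup.mk' _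

/-- A homomorphism out of the Bass group, from its values on the generators. -/
def bassLift {G : Type*} [Group G] (f : ∀ v, 𝕏.VG v →* G) (a : X.E → G)
    (hbar : ∀ e, a e * a (X.bar e) = 1)
    (hedge : ∀ e (g : 𝕏.EG (X.und e)),
      (a e)⁻¹ * f (X.o e) (𝕏.inc (X.bar e) (X.und_bar e) rfl g) * a e =
        f (X.t e) (𝕏.inc e rfl rfl g)) : 𝕏.Bass →* G :=
  PresentedGroup.toGroup (f := Sum.elim (fun p => f p.1 p.2) a) (by
    intro r hr
    cases hr with
    | vertex v g h => simp [genV]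
    | bar e => simpa [genE] using hbar e
    | edge e g => simpa [genE, genV, mul_inv_eq_one] using hedge e g)

open Classical in
/-- The homomorphism `n(·, e₀)` on the Bass group: the number of occurrences of `e₀` minus the
number of occurrences of `bar e₀`. -/
noncomputable def edgeCount (e₀ : X.E) : 𝕏.Bass →* Multiplicative ℤ :=
  𝕏.bassLift (fun _ => 1)
    (fun e => Multiplicative.ofAdd
      ((if e = e₀ then (1 : ℤ) else 0) - (if e = X.bar e₀ then (1 : ℤ) else 0)))
    (by
      intro e
      have h1 : (X.bar e = e₀) ↔ (e = X.bar e₀) :=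
        ⟨fun h => by rw [← h, X.bar_bar], fun h => by rw [h, X.bar_bar]⟩
      have h2 : (X.bar e = X.bar e₀) ↔ (e = e₀) :=
        ⟨fun h => by rw [← X.bar_bar e, h, X.bar_bar], fun h => by rw [h]⟩
      rw [← ofAdd_add, ofAdd_eq_one]
      simp only [h1, h2]
      ring)
    (by intro e g; simp only [MonoidHom.one_apply, mul_one, inv_mul_cancel])

/-- An isomorphism of graphs of groups `(Φ_X, (φ_v), (φ_e), (γ_e))` over the graph isomorphism
`Φ_X`, with `φ_{t(e)} ∘ i_e = ad_{γ_e} ∘ i_{Φ_X(e)} ∘ φ_e` for all `e`, where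
`ad_γ x = γ⁻¹ x γ`. -/
structure IsoOver {X Y : SerreGraph} (Φ : X.Iso Y) (𝕏 : GraphOfGroups X)
    (𝕐 : GraphOfGroups Y) where
  onV : ∀ v, 𝕏.VG v ≃* 𝕐.VG (Φ.onV v)
  onE : ∀ u, 𝕏.EG u ≃* 𝕐.EG (Φ.onU u)
  γ : ∀ e, 𝕐.VG (Φ.onV (X.t e))
  comm : ∀ e (g : 𝕏.EG (X.und e)),
    onV (X.t e) (𝕏.inc e rfl rfl g) =
      (γ e)⁻¹ * 𝕐.inc (Φ.onE e) (Φ.und_onE e) (Φ.map_t e) (onE (X.und e) g) * γ e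

/-- Compatibility of the homomorphisms `i_e`, for both ends of an edge, in the Bass group. -/
theorem edge_rel (e : X.E) {u : X.UEdge} {v w : X.V} (hu : X.und e = u)
    (hu' : X.und (X.bar e) = u) (hv : X.t e = v) (hw : X.t (X.bar e) = w) (g : 𝕏.EG u) :
    (𝕏.edge e)⁻¹ * 𝕏.vert w (𝕏.inc (X.bar e) hu' hw g) * 𝕏.edge e =
      𝕏.vert v (𝕏.inc e hu hv g) := by
  subst hu hv hw
  have := PresentedGroup.one_of_mem (rels := {r | 𝕏.BassRel r}) (BassRel.edge e g)
  rw [map_mul, map_mul, map_mul, map_inv, map_inv, mul_inv_eq_one] at this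
  exact this

theorem IsoOver.comm' {X Y : SerreGraph} {Φ : X.Iso Y} {𝕏 : GraphOfGroups X}
    {𝕐 : GraphOfGroups Y} (Ψ : IsoOver Φ 𝕏 𝕐) (e : X.E) {u : X.UEdge} (hu : X.und e = u)
    (g : 𝕏.EG u) :
    Ψ.onV (X.t e) (𝕏.inc e hu rfl g) =
      (Ψ.γ e)⁻¹ * 𝕐.inc (Φ.onE e) (hu ▸ Φ.und_onE e) (Φ.map_t e) (Ψ.onE u g) * Ψ.γ e := by
  subst hu
  exact Ψ.comm e g

/-- The homomorphism induced on Bass groups: it restricts to `φ_v` on the vertex groups and sends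
`e` to `γ_{bar e}⁻¹ Φ_X(e) γ_e`. -/
def IsoOver.bassMap {X Y : SerreGraph} {Φ : X.Iso Y} {𝕏 : GraphOfGroups X}
    {𝕐 : GraphOfGroups Y} (Ψ : IsoOver Φ 𝕏 𝕐) : 𝕏.Bass →* 𝕐.Bass :=
  𝕏.bassLift (fun v => (𝕐.vert (Φ.onV v)).comp (Ψ.onV v).toMonoidHom)
    (fun e => (𝕐.vert _ (Ψ.γ (X.bar e)))⁻¹ * 𝕐.edge (Φ.onE e) * 𝕐.vert _ (Ψ.γ e))
    (by
      intro e
      have h : 𝕐.vert _ (Ψ.γ (X.bar (X.bar e))) = 𝕐.vert _ (Ψ.γ e) := by rw [X.bar_bar]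
      rw [h, Φ.map_bar, 𝕐.edge_bar]
      group)
    (by
      intro e g
      have hb : ∀ (e' : Y.E) (he : Φ.onE (X.bar e) = e') (hu : Y.und e' = Φ.onU (X.und e))
          (hw : Y.t e' = Φ.onV (X.t (X.bar e))),
          𝕐.inc (Φ.onE (X.bar e)) (he ▸ hu) (he ▸ hw) = 𝕐.inc e' hu hw := by
        rintro e' rfl hu hw; rfl
      have hu : Y.und (Y.bar (Φ.onE e)) = Φ.onU (X.und e) := by
        rw [Y.und_bar, Φ.und_onE]
      have hw : Y.t (Y.bar (Φ.onE e)) = Φ.onV (X.t (X.bar e)) := by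
        rw [← Φ.map_bar, Φ.map_t]
      have key := 𝕐.edge_rel (Φ.onE e) (Φ.und_onE e) hu (Φ.map_t e) hw (Ψ.onE (X.und e) g)
      have h1 := congrArg (𝕐.vert _) (Ψ.comm' (X.bar e) (X.und_bar e) g)
      have h2 := congrArg (𝕐.vert _) (Ψ.comm e g)
      rw [hb _ (Φ.map_bar e) hu hw] at h1
      simp only [map_mul, map_inv] at h1 h2
      change _ * 𝕐.vert _ (Ψ.onV (X.t (X.bar e)) _) * _ = 𝕐.vert _ (Ψ.onV (X.t e) _)
      rw [h1, h2, ← key]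
      group)

end GraphOfGroups

/-! Decompositions of suspensions -/

section Decomposition

variable {F : Type*} [Group F] {X : SerreGraph}

/-- The height homomorphism on `π₁(𝕏, τ)`, given an identification `θ` with a suspension. -/
def treeHeight {φ : MulAut F} (𝕏 : GraphOfGroups X) {τ : Set X.E}
    (θ : 𝕏.FundTree τ ≃* Suspension φ) : 𝕏.FundTree τ →* Multiplicative ℤ :=
  (Suspension.height φ).comp θ.toMonoidHom

/-- The height homomorphism on the Bass group, through its quotient `π₁(𝕏, τ)`. -/
def bassHeight {φ : MulAut F} (𝕏 : GraphOfGroups X) {τ : Set X.E}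
    (θ : 𝕏.FundTree τ ≃* Suspension φ) : 𝕏.Bass →* Multiplicative ℤ :=
  (treeHeight 𝕏 θ).comp (𝕏.toFundTree τ)

/-- The height homomorphism on the vertex group at `v`; its kernel is the intersection of the
vertex group with the fiber. -/
def vertHeight {φ : MulAut F} (𝕏 : GraphOfGroups X) {τ : Set X.E}
    (θ : 𝕏.FundTree τ ≃* Suspension φ) (v : X.V) : 𝕏.VG v →* Multiplicative ℤ :=
  (bassHeight 𝕏 θ).comp (𝕏.vert v)

/-- The edge groups are cyclic, generated by the elements `c u`, which are chosen positive for
the orientation whenever the edge group is not contained in the fiber. -/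
def IsCyclicMarking {φ : MulAut F} (𝕏 : GraphOfGroups X) {τ : Set X.E}
    (θ : 𝕏.FundTree τ ≃* Suspension φ) (c : ∀ u, 𝕏.EG u) : Prop :=
  (∀ u, Subgroup.zpowers (c u) = ⊤) ∧
    ∀ e, 0 ≤ (vertHeight 𝕏 θ (X.t e) (𝕏.inc e rfl rfl (c (X.und e)))).toAdd

/-- The peripheral structure of the vertex group at `v`: the images of the generators of the
adjacent edge groups. -/
def peripheral (𝕏 : GraphOfGroups X) (c : ∀ u, 𝕏.EG u) (v : X.V) :
    {e : X.E // X.t e = v} → 𝕏.VG v :=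
  fun e => 𝕏.inc e.1 rfl e.2 (c (X.und e.1))

/-- The peripheral structure at the vertex `Φ v`, indexed through `Φ` by the edges at `v`. -/
def peripheralOver {Y : SerreGraph} (Φ : X.Iso Y) (𝕐 : GraphOfGroups Y) (c : ∀ u, 𝕐.EG u)
    (v : X.V) : {e : X.E // X.t e = v} → 𝕐.VG (Φ.onV v) :=
  fun e => peripheral 𝕐 c (Φ.onV v) ⟨Φ.onE e.1, by rw [Φ.map_t, e.2]⟩

/-- The isomorphism `Φ` of fundamental groups is, as an outer isomorphism, the one induced by the
isomorphism `Ψ` of graphs of groups. -/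
def InducedBy {Y : SerreGraph} {ΦX : X.Iso Y} {𝕏 : GraphOfGroups X} {𝕐 : GraphOfGroups Y}
    {τ : Set X.E} {σ : Set Y.E} (v₀ : X.V) (Φ : 𝕏.FundTree τ ≃* 𝕐.FundTree σ)
    (Ψ : GraphOfGroups.IsoOver ΦX 𝕏 𝕐) : Prop :=
  ∃ g : 𝕐.FundTree σ, ∀ x ∈ 𝕏.FundVertex v₀,
    Φ (𝕏.toFundTree τ x) = g⁻¹ * 𝕐.toFundTree σ (Ψ.bassMap x) * g

/-- The linear Diophantine system
`∑ r_s n(γ_j, e) δ(s) = - δ(γ_j) + dirac_{j = j₀}`, with one equation for each `j` and one unknown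
`r_s` for each `e ∈ P` and `s ∈ S e`, has an integral solution (with finite support, in case
there are infinitely many unknowns). Here `j₀` is `none`. -/
def SystemSolvable {φ : MulAut F} (𝕏 : GraphOfGroups X) {τ : Set X.E}
    (θ : 𝕏.FundTree τ ≃* Suspension φ) (P : Set X.E) (S : ∀ e, Set (𝕏.VG (X.t e)))
    {ι : Type*} (γ : Option ι → 𝕏.Bass) : Prop :=
  ∃ r : (Σ e : P, S e.1) →₀ ℤ, ∀ j,
    (r.sum fun s a => a * (𝕏.edgeCount s.1.1 (γ j)).toAdd *
        (vertHeight 𝕏 θ (X.t s.1.1) s.2.1).toAdd) =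
      -(bassHeight 𝕏 θ (γ j)).toAdd + (if j.isNone then 1 else 0)

end Decomposition

/-! Everything is measured by the height `δ`. Since `δ` maps both suspensions onto ℤ, an isomorphism
between them preserves fiber and orientation exactly when it preserves heights, which can be tested
on the `x_j`. As ℤ is abelian, conjugations leave heights unchanged. So in 1 ⇒ 2 the inducing
isomorphism of graphs of groups already preserves heights of loops, and `r = 0` solves the system.

For 3 ⇒ 1, each `γ_e` may be multiplied by an element centralizing the edge group. This adds to the
height of the image of a loop a linear combination of edge counts, with coefficients the heights of
the centralizing elements. A solution of the system is a choice of such elements correcting the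
heights of all `γ_j` (`exists_twist_system`).

For 2 ⇒ 3, each `φ_v` is replaced by a list element, equal to it up to conjugation by some `g_v` and
up to `K_m`. Lifting centralizers gives new `γ_e` congruent to `γ_e g_{t(e)}` modulo `K_m`
(`exists_conj_congr`). Since `K_m` lies in the fiber, heights change only by the coboundary of
`δ(g_v)`, which vanishes on loops (`IsoOver.map_bassMap_eq_of_path`). Edge counts depend on `Φ_X`
alone, so the system is the same. -/

/-! ### Heights under fiber and orientation preserving isomorphisms. -/

theorem fiberOrientationPreserving_of_height_eq {Γ₁ Γ₂ : Type*} [Group Γ₁] [Group Γ₂]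
    {δ₁ : Γ₁ →* Multiplicative ℤ} {δ₂ : Γ₂ →* Multiplicative ℤ} {φ : Γ₁ ≃* Γ₂}
    (h : ∀ x, δ₂ (φ x) = δ₁ x) : FiberOrientationPreserving δ₁ δ₂ φ := by
  refine ⟨?_, fun t ht => ⟨by rw [h]; exact ht.1, fun g => ?_⟩⟩
  · ext y
    obtain ⟨x, rfl⟩ := φ.surjective y
    simp [Subgroup.mem_map, MonoidHom.mem_ker, h]
  · obtain ⟨x, rfl⟩ := φ.surjective g
    rw [h, h]
    exact ht.2 x

/-- The element `x * t⁻ᵏ` lies in the fiber, hence so does its image. -/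
theorem FiberOrientationPreserving.height_mul {Γ₁ Γ₂ : Type*} [Group Γ₁] [Group Γ₂]
    {δ₁ : Γ₁ →* Multiplicative ℤ} {δ₂ : Γ₂ →* Multiplicative ℤ} {φ : Γ₁ ≃* Γ₂}
    (h : FiberOrientationPreserving δ₁ δ₂ φ) {t x : Γ₁} {k : ℤ}
    (hk : (δ₁ x).toAdd = (δ₁ t).toAdd * k) :
    (δ₂ (φ x)).toAdd = (δ₂ (φ t)).toAdd * k := by
  have hx : x * (t ^ k)⁻¹ ∈ δ₁.ker := by
    rw [MonoidHom.mem_ker, map_mul, map_inv, map_zpow, mul_inv_eq_one]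
    apply Multiplicative.toAdd.injective
    rw [hk, toAdd_zpow, smul_eq_mul, mul_comm]
  have h2 : φ (x * (t ^ k)⁻¹) ∈ δ₂.ker := by
    rw [← h.1]
    exact Subgroup.mem_map_of_mem _ hx
  rw [MonoidHom.mem_ker, map_mul, map_inv, map_zpow, map_mul, map_inv, map_zpow,
    mul_inv_eq_one] at h2
  rw [h2, toAdd_zpow, smul_eq_mul, mul_comm]

/-- An element of height 1 has a transverse image, whose height is positive and divides 1; this
fixes the scale. -/
theorem FiberOrientationPreserving.height_eq {Γ₁ Γ₂ : Type*} [Group Γ₁] [Group Γ₂]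
    {δ₁ : Γ₁ →* Multiplicative ℤ} {δ₂ : Γ₂ →* Multiplicative ℤ} {φ : Γ₁ ≃* Γ₂}
    (h : FiberOrientationPreserving δ₁ δ₂ φ) (h₁ : Function.Surjective δ₁)
    (h₂ : Function.Surjective δ₂) (x : Γ₁) : δ₂ (φ x) = δ₁ x := by
  obtain ⟨t, ht⟩ := h₁ (Multiplicative.ofAdd 1)
  have htt : IsTransverse δ₁ t := by simp [IsTransverse, ht]
  obtain ⟨hp, hd⟩ := h.2 t htt
  obtain ⟨s, hs⟩ := h₂ (Multiplicative.ofAdd 1)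
  have h1 := hd s
  rw [hs, toAdd_ofAdd] at h1
  have h2 : (δ₂ (φ t)).toAdd = 1 := Int.eq_one_of_dvd_one hp.le h1
  have := h.height_mul (t := t) (x := x) (k := (δ₁ x).toAdd) (by simp [ht])
  rw [h2, one_mul] at this
  exact Multiplicative.toAdd.injective this

theorem exists_isTransverse {Γ : Type*} [Group Γ] (δ : Γ →* Multiplicative ℤ) {x : Γ}
    (hx : (δ x).toAdd ≠ 0) : ∃ t, IsTransverse δ t := by
  obtain ⟨⟨_, t, rfl⟩, hg⟩ := IsCyclic.exists_generator (α := δ.range)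
  have hd : ∀ y, (δ t).toAdd ∣ (δ y).toAdd := fun y => by
    obtain ⟨k, hk⟩ := Subgroup.mem_zpowers_iff.1 (hg ⟨δ y, y, rfl⟩)
    have := congrArg (fun z : δ.range => (z : Multiplicative ℤ).toAdd) hk
    simp only [SubgroupClass.coe_zpow, toAdd_zpow, smul_eq_mul] at this
    exact ⟨k, by rw [← this, mul_comm]⟩
  have h0 : (δ t).toAdd ≠ 0 := fun h => hx (by simpa [h] using hd x)
  rcases lt_or_gt_of_ne h0 with h | h
  · exact ⟨t⁻¹, by simpa using h, fun y => by simpa using hd y⟩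
  · exact ⟨t, h, hd⟩

theorem FiberOrientationPreserving.height_pos {Γ₁ Γ₂ : Type*} [Group Γ₁] [Group Γ₂]
    {δ₁ : Γ₁ →* Multiplicative ℤ} {δ₂ : Γ₂ →* Multiplicative ℤ} {φ : Γ₁ ≃* Γ₂}
    (h : FiberOrientationPreserving δ₁ δ₂ φ) {x : Γ₁} (hx : 0 < (δ₁ x).toAdd) :
    0 < (δ₂ (φ x)).toAdd := by
  obtain ⟨t, ht⟩ := exists_isTransverse δ₁ hx.ne'
  obtain ⟨k, hk⟩ := ht.2 x
  rw [h.height_mul hk]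
  rw [hk] at hx
  exact mul_pos (h.2 t ht).1 (pos_of_mul_pos_right hx ht.1.le)

/-- The fiber is normal and contains the generators; hence working modulo `K_m` loses no height. -/
theorem fillingKernel_le_ker {Γ : Type*} [Group Γ] (δ : Γ →* Multiplicative ℤ) (m : ℕ) :
    fillingKernel δ m ≤ δ.ker := by
  refine Subgroup.normalClosure_le_normal ?_
  rintro _ ⟨_, _, y, _, rfl⟩
  exact y.2

/-! ### Edge paths and maximal subtrees. -/

namespace SerreGraph

variable {X Y : SerreGraph}

theorem IsEdgePath.append {l l' : List X.E} {u v w : X.V} (h : X.IsEdgePath u l v)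
    (h' : X.IsEdgePath v l' w) : X.IsEdgePath u (l ++ l') w := by
  induction l generalizing u with
  | nil => cases h; exact h'
  | cons e l ih => exact ⟨h.1, ih h.2⟩

theorem isEdgePath_singleton (X : SerreGraph) (e : X.E) : X.IsEdgePath (X.o e) [e] (X.t e) :=
  ⟨rfl, rfl⟩

theorem IsEdgePath.of_append {l l' : List X.E} {u w : X.V} (h : X.IsEdgePath u (l ++ l') w) :
    ∃ v, X.IsEdgePath u l v ∧ X.IsEdgePath v l' w := by
  induction l generalizing u with
  | nil => exact ⟨u, rfl, h⟩
  | cons e l ih =>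
    obtain ⟨v, h1, h2⟩ := ih h.2
    exact ⟨v, ⟨h.1, h1⟩, h2⟩

theorem Iso.map_o (Φ : X.Iso Y) (e : X.E) : Y.o (Φ.onE e) = Φ.onV (X.o e) := by
  rw [o, ← Φ.map_bar, Φ.map_t]

theorem IsEdgePath.map (Φ : X.Iso Y) {l : List X.E} {v w : X.V} (h : X.IsEdgePath v l w) :
    Y.IsEdgePath (Φ.onV v) (l.map Φ.onE) (Φ.onV w) := by
  induction l generalizing v with
  | nil => exact congrArg _ h
  | cons e l ih =>
    refine ⟨by rw [Φ.map_o, h.1], ?_⟩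
    rw [Φ.map_t]
    exact ih h.2

/-- The edge paths from `v₀` in a maximal subtree, compatible with the edges of the subtree in
every labelling of the edges by elements of a group. -/
theorem IsMaximalSubtree.exists_paths {τ : Set X.E} (hτ : X.IsMaximalSubtree τ) (v₀ : X.V) :
    ∃ l : X.V → List X.E, (∀ v, X.IsEdgePath v₀ (l v) v) ∧ (∀ v, ∀ e ∈ l v, e ∈ τ) ∧
      ∀ e ∈ τ, l (X.t e) = l (X.o e) ++ [e] ∨ l (X.o e) = l (X.t e) ++ [X.bar e] := by
  choose l hl huniq using hτ.2 v₀
  refine ⟨l, fun v => (hl v).1, fun v => (hl v).2.1, fun e he => ?_⟩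
  obtain ⟨h1, h2, h3⟩ := hl (X.o e)
  -- Appending `e` to the reduced path ending at `o(e)` keeps it reduced unless its last edge is
  -- `bar e`; in that case deleting this edge gives the reduced path to `t(e)`.
  rcases List.eq_nil_or_concat (l (X.o e)) with h0 | ⟨l', a, h0⟩
  · left
    refine (huniq _ _ ⟨h1.append (X.isEdgePath_singleton e), ?_, ?_⟩).symm
    · simp [h0, he]
    · simp [h0]
  · rw [List.concat_eq_append] at h0
    rw [h0] at h1 h2 h3
    by_cases ha : e = X.bar a
    · right
      have hb : X.bar e = a := by rw [ha, X.bar_bar]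
      obtain ⟨v, hv, hv'⟩ := h1.of_append
      obtain rfl : X.t e = v := by rw [ha]; exact hv'.1
      rw [hb, ← huniq (X.t e) l' ⟨hv, fun x hx => h2 x (by simp [hx]), h3.left_of_append⟩, h0]
    · left
      refine (huniq _ _ ⟨(hl (X.o e)).1.append (X.isEdgePath_singleton e), ?_, ?_⟩).symm
      · intro x hx
        rcases List.mem_append.1 hx with hx | hx
        · exact (hl (X.o e)).2.1 x hx
        · rw [List.mem_singleton.1 hx]; exact he
      · rw [List.isChain_append]
        refine ⟨(hl (X.o e)).2.2, List.isChain_singleton _, ?_⟩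
        rw [h0]
        simpa using ha

end SerreGraph

/-! ### The two models of the fundamental group. -/

namespace GraphOfGroups

variable {X Y : SerreGraph} (𝕏 : GraphOfGroups X) {𝕐 : GraphOfGroups Y}

theorem bassHom_ext {G : Type*} [Group G] {f g : 𝕏.Bass →* G}
    (hv : ∀ v h, f (𝕏.vert v h) = g (𝕏.vert v h)) (he : ∀ e, f (𝕏.edge e) = g (𝕏.edge e)) :
    f = g :=
  PresentedGroup.ext (by
    rintro (⟨v, h⟩ | e)
    · exact hv v h
    · exact he e)

theorem eq_top_of_generators_mem {H : Subgroup 𝕏.Bass} (hv : ∀ v g, 𝕏.vert v g ∈ H)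
    (he : ∀ e, 𝕏.edge e ∈ H) : H = ⊤ := by
  rw [eq_top_iff, ← PresentedGroup.closure_range_of, Subgroup.closure_le]
  rintro _ ⟨⟨v, g⟩ | e, rfl⟩
  · exact hv v g
  · exact he e

section

variable {G : Type*} [Group G] (f : ∀ v, 𝕏.VG v →* G) (a : X.E → G)
    (hbar : ∀ e, a e * a (X.bar e) = 1)
    (hedge : ∀ e (g : 𝕏.EG (X.und e)),
      (a e)⁻¹ * f (X.o e) (𝕏.inc (X.bar e) (X.und_bar e) rfl g) * a e =
        f (X.t e) (𝕏.inc e rfl rfl g))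

@[simp]
theorem bassLift_vert (v : X.V) (g : 𝕏.VG v) :
    𝕏.bassLift f a hbar hedge (𝕏.vert v g) = f v g :=
  PresentedGroup.toGroup.of _

@[simp]
theorem bassLift_edge (e : X.E) : 𝕏.bassLift f a hbar hedge (𝕏.edge e) = a e :=
  PresentedGroup.toGroup.of _

end

/-- The element of the Bass group attached to a list of edges. -/
def pathProd (l : List X.E) : 𝕏.Bass := (l.map 𝕏.edge).prod

theorem pathProd_append_singleton (l : List X.E) (e : X.E) :
    𝕏.pathProd (l ++ [e]) = 𝕏.pathProd l * 𝕏.edge e := by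
  simp [pathProd]

theorem isPathElement_one (v : X.V) : 𝕏.IsPathElement v v 1 := by
  simpa using IsPathElement.vertex (𝕏 := 𝕏) v 1

theorem isPathElement_pathProd {l : List X.E} {v w : X.V} (h : X.IsEdgePath v l w) :
    𝕏.IsPathElement v w (𝕏.pathProd l) := by
  induction l generalizing v with
  | nil =>
    obtain rfl : v = w := h
    exact 𝕏.isPathElement_one v
  | cons e l ih =>
    obtain ⟨rfl, h⟩ := h
    simpa [pathProd] using (IsPathElement.edge 𝕏 e).mul 𝕏 (ih h)

theorem toFundTree_edge {τ : Set X.E} {e : X.E} (he : e ∈ τ) :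
    𝕏.toFundTree τ (𝕏.edge e) = 1 :=
  (QuotientGroup.eq_one_iff _).2 (Subgroup.subset_normalClosure ⟨e, he, rfl⟩)

/-- A choice of path elements from `v₀` to all the vertices, carried by a subtree `τ`. -/
structure IsTreeFrame (τ : Set X.E) (v₀ : X.V) (p : X.V → 𝕏.Bass) : Prop where
  path v : 𝕏.IsPathElement v₀ v (p v)
  map_one : ∀ v, 𝕏.toFundTree τ (p v) = 1
  base : p v₀ = 1
  edge : ∀ e ∈ τ, p (X.o e) * 𝕏.edge e = p (X.t e)

/-- Paths are taken in `τ` and pushed forward by `Φ`, so the image of `τ` need not be shown to be a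
maximal subtree. -/
theorem exists_isTreeFrame_map (Φ : X.Iso Y) (𝕐 : GraphOfGroups Y) {τ : Set X.E}
    (hτ : X.IsMaximalSubtree τ) (v₀ : X.V) :
    ∃ p, 𝕐.IsTreeFrame (Φ.onE '' τ) (Φ.onV v₀) p := by
  obtain ⟨l, hl, hlτ, hle⟩ := hτ.exists_paths v₀
  let q : Y.V → 𝕐.Bass := fun w => 𝕐.pathProd ((l (Φ.onV.symm w)).map Φ.onE)
  have hq : ∀ w, 𝕐.IsPathElement (Φ.onV v₀) w (q w) := fun w => by
    have := 𝕐.isPathElement_pathProd ((hl (Φ.onV.symm w)).map Φ)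
    rwa [Φ.onV.apply_symm_apply] at this
  have hq1 : ∀ w, 𝕐.toFundTree (Φ.onE '' τ) (q w) = 1 := fun w => by
    simp only [q]
    rw [pathProd, map_list_prod]
    refine List.prod_eq_one ?_
    simp only [List.map_map, List.mem_map]
    rintro _ ⟨e, he, rfl⟩
    exact 𝕐.toFundTree_edge ⟨e, hlτ _ e he, rfl⟩
  -- Dividing by the value at the base vertex makes the frame trivial there by construction.
  refine ⟨fun w => (q (Φ.onV v₀))⁻¹ * q w, fun w => ((hq _).inv 𝕐).mul 𝕐 (hq w), fun w => ?_,
    inv_mul_cancel _, ?_⟩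
  · rw [map_mul, map_inv, hq1, hq1, inv_one, one_mul]
  · rintro _ ⟨e, he, rfl⟩
    rw [mul_assoc, Φ.map_o, Φ.map_t]
    simp only [q, Equiv.symm_apply_apply]
    rcases hle e he with h | h
    · rw [h, List.map_append, List.map_singleton, pathProd_append_singleton]
    · rw [h, List.map_append, List.map_singleton, pathProd_append_singleton, Φ.map_bar,
        edge_bar, inv_mul_cancel_right]

theorem exists_isTreeFrame {τ : Set X.E} (hτ : X.IsMaximalSubtree τ) (v₀ : X.V) :
    ∃ p, 𝕏.IsTreeFrame τ v₀ p := by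
  have := exists_isTreeFrame_map ⟨Equiv.refl _, Equiv.refl _, fun _ => rfl, fun _ => rfl⟩ 𝕏 hτ v₀
  simpa using this

variable {𝕏}

namespace IsTreeFrame

variable {τ : Set X.E} {v₀ : X.V} {p : X.V → 𝕏.Bass} (hp : 𝕏.IsTreeFrame τ v₀ p)

/-- The retraction of the Bass group onto `π₁(𝕏, v₀)` determined by a tree frame. -/
def retraction (_ : 𝕏.IsTreeFrame τ v₀ p) : 𝕏.Bass →* 𝕏.Bass :=
  𝕏.bassLift (fun v => (MulAut.conj (p v)).toMonoidHom.comp (𝕏.vert v))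
    (fun e => p (X.o e) * 𝕏.edge e * (p (X.t e))⁻¹)
    (fun e => by
      rw [𝕏.edge_bar, SerreGraph.o, SerreGraph.o, X.bar_bar]
      group)
    (fun e g => by
      have := 𝕏.edge_rel e rfl (X.und_bar e) rfl rfl g
      simp only [MonoidHom.comp_apply, MulEquiv.toMonoidHom_eq_coe, MonoidHom.coe_coe,
        MulAut.conj_apply]
      rw [← this]
      group)

/-- The frame elements at intermediate vertices cancel along the path. -/
theorem retraction_of_path {v w : X.V} {x : 𝕏.Bass} (hx : 𝕏.IsPathElement v w x) :
    hp.retraction x = p v * x * (p w)⁻¹ := by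
  induction hx with
  | vertex v g => simp [retraction]
  | cons e g w x _ ih =>
    rw [map_mul, map_mul, ih]
    simp only [retraction, bassLift_vert, bassLift_edge, MonoidHom.comp_apply,
      MulEquiv.toMonoidHom_eq_coe, MonoidHom.coe_coe, MulAut.conj_apply]
    group

theorem retraction_of_mem {x : 𝕏.Bass} (hx : x ∈ 𝕏.FundVertex v₀) : hp.retraction x = x := by
  rw [hp.retraction_of_path hx, hp.base, one_mul, inv_one, mul_one]

theorem retraction_mem (x : 𝕏.Bass) : hp.retraction x ∈ 𝕏.FundVertex v₀ := by
  have : (𝕏.FundVertex v₀).comap hp.retraction = ⊤ := by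
    refine 𝕏.eq_top_of_generators_mem (fun v g => ?_) fun e => ?_
    · simp only [Subgroup.mem_comap, retraction, bassLift_vert, MonoidHom.comp_apply,
        MulEquiv.toMonoidHom_eq_coe, MonoidHom.coe_coe, MulAut.conj_apply]
      exact ((hp.path v).mul 𝕏 (.vertex v g)).mul 𝕏 ((hp.path v).inv 𝕏)
    · simp only [Subgroup.mem_comap, retraction, bassLift_edge]
      exact ((hp.path _).mul 𝕏 (.edge 𝕏 e)).mul 𝕏 ((hp.path _).inv 𝕏)
  exact (this ▸ Subgroup.mem_top x : x ∈ (𝕏.FundVertex v₀).comap hp.retraction)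

theorem toFundTree_retraction (x : 𝕏.Bass) :
    𝕏.toFundTree τ (hp.retraction x) = 𝕏.toFundTree τ x := by
  have : (𝕏.toFundTree τ).comp hp.retraction = 𝕏.toFundTree τ := by
    refine 𝕏.bassHom_ext (fun v g => ?_) fun e => ?_
    · simp [retraction, hp.map_one]
    · simp [retraction, hp.map_one]
  exact DFunLike.congr_fun this x

theorem normalClosure_le_ker (hp : 𝕏.IsTreeFrame τ v₀ p) :
    Subgroup.normalClosure (𝕏.edge '' τ) ≤ hp.retraction.ker := by
  refine Subgroup.normalClosure_le_normal ?_
  rintro _ ⟨e, he, rfl⟩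
  rw [SetLike.mem_coe, MonoidHom.mem_ker, retraction, bassLift_edge, hp.edge e he,
    mul_inv_cancel]

/-- The retraction kills the edges of `τ`, so it factors through `π₁(𝕏, τ)`, and it fixes loops at
`v₀`. -/
theorem eq_one_of_toFundTree_eq_one (hp : 𝕏.IsTreeFrame τ v₀ p) {x : 𝕏.Bass} (hx : x ∈ 𝕏.FundVertex v₀)
    (h : 𝕏.toFundTree τ x = 1) : x = 1 := by
  have := hp.normalClosure_le_ker ((QuotientGroup.eq_one_iff x).1 h)
  rwa [MonoidHom.mem_ker, hp.retraction_of_mem hx] at this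

end IsTreeFrame

/-! ### The map of Bass groups induced by an isomorphism of graphs of groups. -/

variable {Φ : X.Iso Y} (Ψ : IsoOver Φ 𝕏 𝕐)

namespace IsoOver

@[simp]
theorem bassMap_vert (v : X.V) (g : 𝕏.VG v) :
    Ψ.bassMap (𝕏.vert v g) = 𝕐.vert (Φ.onV v) (Ψ.onV v g) :=
  𝕏.bassLift_vert _ _ _ _ _ _

theorem bassMap_edge (e : X.E) :
    Ψ.bassMap (𝕏.edge e) =
      (𝕐.vert _ (Ψ.γ (X.bar e)))⁻¹ * 𝕐.edge (Φ.onE e) * 𝕐.vert _ (Ψ.γ e) :=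
  𝕏.bassLift_edge _ _ _ _ _

theorem isPathElement_edge (𝕐 : GraphOfGroups Y) (Φ : X.Iso Y) (e : X.E) :
    𝕐.IsPathElement (Φ.onV (X.o e)) (Φ.onV (X.t e)) (𝕐.edge (Φ.onE e)) := by
  have := IsPathElement.edge 𝕐 (Φ.onE e)
  rwa [Φ.map_o, Φ.map_t] at this

theorem isPathElement_bassMap {v w : X.V} {x : 𝕏.Bass} (hx : 𝕏.IsPathElement v w x) :
    𝕐.IsPathElement (Φ.onV v) (Φ.onV w) (Ψ.bassMap x) := by
  induction hx with
  | vertex v g => rw [bassMap_vert]; exact .vertex _ _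
  | cons e g w x _ ih =>
    rw [map_mul, map_mul, bassMap_vert, bassMap_edge, ← map_inv]
    exact ((IsPathElement.vertex _ _).mul 𝕐 (((IsPathElement.vertex _ _).mul 𝕐
      (isPathElement_edge 𝕐 Φ e)).mul 𝕐 (.vertex _ _))).mul 𝕐 ih

/-- Path elements lift syllable by syllable: `Φ(e)` is the image of `e` flanked by the preimages of
`γ_{bar e}` and `γ_e⁻¹`. -/
theorem exists_bassMap_eq {a b : Y.V} {y : 𝕐.Bass} (hy : 𝕐.IsPathElement a b y) :
    ∀ v w, Φ.onV v = a → Φ.onV w = b → ∃ x, 𝕏.IsPathElement v w x ∧ Ψ.bassMap x = y := by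
  induction hy with
  | vertex a g =>
    rintro v w rfl h
    obtain rfl := Φ.onV.injective h
    exact ⟨_, .vertex w ((Ψ.onV w).symm g), by simp⟩
  | cons e' g b y _ ih =>
    rintro v w hv rfl
    obtain ⟨e, rfl⟩ := Φ.onE.surjective e'
    obtain ⟨x, hx, rfl⟩ := ih _ _ (Φ.map_t e).symm rfl
    have hg : ∃ k : 𝕏.VG v, Ψ.bassMap (𝕏.vert v k) = 𝕐.vert (Y.o (Φ.onE e)) g := by
      clear ih hx
      revert g
      rw [← hv]
      exact fun g => ⟨(Ψ.onV v).symm g, by simp⟩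
    obtain ⟨k, hk⟩ := hg
    rw [Φ.map_o] at hv
    obtain rfl := Φ.onV.injective hv
    refine ⟨𝕏.vert _ k * (𝕏.vert _ ((Ψ.onV _).symm (Ψ.γ (X.bar e))) * 𝕏.edge e *
      𝕏.vert _ ((Ψ.onV _).symm (Ψ.γ e))⁻¹) * x, ?_, ?_⟩
    · exact ((IsPathElement.vertex _ _).mul 𝕏 (((IsPathElement.vertex _ _).mul 𝕏
        (.edge 𝕏 e)).mul 𝕏 (.vertex _ _))).mul 𝕏 hx
    · rw [map_mul, map_mul, hk, map_mul, map_mul, bassMap_edge, bassMap_vert, bassMap_vert]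
      simp only [map_inv, MulEquiv.apply_symm_apply]
      group

/-- A left inverse is built from the inverses of the vertex isomorphisms, sending `Φ(e)` to `γ_{bar
e} e γ_e⁻¹` with the `γ`'s pulled back. -/
theorem bassMap_injective : Function.Injective Ψ.bassMap := by
  have hex : ∀ w, ∃ f : 𝕐.VG w →* 𝕏.Bass, ∀ v (h : Φ.onV v = w) (g : 𝕏.VG v),
      f (h ▸ Ψ.onV v g) = 𝕏.vert v g := by
    intro w
    obtain ⟨v, rfl⟩ := Φ.onV.surjective w
    refine ⟨(𝕏.vert v).comp (Ψ.onV v).symm.toMonoidHom, fun v' h g => ?_⟩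
    obtain rfl := Φ.onV.injective h
    simp
  choose f hf using hex
  replace hf : ∀ v (g : 𝕏.VG v), f _ (Ψ.onV v g) = 𝕏.vert v g := fun v g => hf _ v rfl g
  -- The free variable `e'` lets the identity be used at `bar (Φ e)`, which is only propositionally
  -- `Φ (bar e)`.
  have hinc : ∀ (e : X.E) (u : X.UEdge) (hu : X.und e = u) (k : 𝕏.EG u) (e' : Y.E)
      (_ : e' = Φ.onE e) (hu' : Y.und e' = Φ.onU u),
      f (Y.t e') (𝕐.inc e' hu' rfl (Ψ.onE _ k)) =
        f _ (Ψ.γ e) * 𝕏.vert _ (𝕏.inc e hu rfl k) * (f _ (Ψ.γ e))⁻¹ := by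
    rintro e u hu k _ rfl hu'
    have hw : ∀ w (h : Y.t (Φ.onE e) = w),
        f (Y.t (Φ.onE e)) (𝕐.inc (Φ.onE e) hu' rfl (Ψ.onE _ k)) =
          f w (𝕐.inc (Φ.onE e) hu' h (Ψ.onE _ k)) := by
      rintro _ rfl; rfl
    rw [hw _ (Φ.map_t e), ← hf, Ψ.comm' e hu]
    simp only [map_mul, map_inv]
    group
  have hγ : ∀ e, f _ (Ψ.γ (X.bar (X.bar e))) = f _ (Ψ.γ e) := fun e => by rw [X.bar_bar]
  let a : X.E → 𝕏.Bass := fun e => f _ (Ψ.γ (X.bar e)) * 𝕏.edge e * (f _ (Ψ.γ e))⁻¹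
  have ha : ∀ e, a (Φ.onE.symm (Φ.onE e)) = a e := fun e => by rw [Equiv.symm_apply_apply]
  let inv : 𝕐.Bass →* 𝕏.Bass := 𝕐.bassLift f (fun e' => a (Φ.onE.symm e'))
    (fun e' => by
      obtain ⟨e, rfl⟩ := Φ.onE.surjective e'
      rw [← Φ.map_bar, ha, ha]
      simp only [a]
      rw [hγ, edge_bar]
      group)
    (fun e' g => by
      obtain ⟨e, rfl⟩ := Φ.onE.surjective e'
      obtain ⟨k, rfl⟩ := (Ψ.onE (X.und e)).surjective g
      rw [ha]
      have h1 := hinc e _ rfl k _ rfl rfl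
      have h2 := hinc (X.bar e) _ (X.und_bar e) k _ (Φ.map_bar e).symm (Y.und_bar _)
      refine (congrArg (fun z => (a e)⁻¹ * z * a e) h2).trans (Eq.trans ?_ h1.symm)
      rw [← 𝕏.edge_rel e rfl (X.und_bar e) rfl rfl k]
      simp only [a]
      group)
  have hid : inv.comp Ψ.bassMap = MonoidHom.id _ := by
    refine 𝕏.bassHom_ext (fun v g => ?_) fun e => ?_
    · simp [inv, hf]
    · simp only [MonoidHom.comp_apply, bassMap_edge, map_mul, map_inv, inv, bassLift_vert,
        bassLift_edge, ha, a, MonoidHom.id_apply]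
      group
  exact Function.LeftInverse.injective (g := inv) fun x => DFunLike.congr_fun hid x

end IsoOver

end GraphOfGroups

/-! ### Edge counts, induced isomorphisms and twists. -/

namespace GraphOfGroups

variable {X Y : SerreGraph} {𝕏 : GraphOfGroups X} {𝕐 : GraphOfGroups Y} {Φ : X.Iso Y}

@[simp]
theorem edgeCount_vert (e₀ : Y.E) (v : Y.V) (g : 𝕐.VG v) :
    𝕐.edgeCount e₀ (𝕐.vert v g) = 1 := by
  simp [edgeCount]

open Classical in
theorem toAdd_edgeCount_edge (e₀ e : Y.E) :
    (𝕐.edgeCount e₀ (𝕐.edge e)).toAdd =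
      (if e₀ = e then 1 else 0) - (if e₀ = Y.bar e then 1 else 0) := by
  have h : e = Y.bar e₀ ↔ e₀ = Y.bar e :=
    ⟨fun h => by rw [h, Y.bar_bar], fun h => by rw [h, Y.bar_bar]⟩
  simp [edgeCount, h, eq_comm (a := e) (b := e₀)]

/-- An isomorphism of graphs of groups induces, up to the identifications with the groups of loops,
an isomorphism of fundamental groups. -/
theorem IsoOver.exists_fundTree_equiv (Ψ : IsoOver Φ 𝕏 𝕐) {τ : Set X.E} {σ : Set Y.E} {v₀ : X.V}
    {p : X.V → 𝕏.Bass} (hp : 𝕏.IsTreeFrame τ v₀ p) {q : Y.V → 𝕐.Bass}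
    (hq : 𝕐.IsTreeFrame σ (Φ.onV v₀) q) :
    ∃ Θ : 𝕏.FundTree τ ≃* 𝕐.FundTree σ, ∀ x ∈ 𝕏.FundVertex v₀,
      Θ (𝕏.toFundTree τ x) = 𝕐.toFundTree σ (Ψ.bassMap x) := by
  -- The induced map sends tree edges to `γ_{bar e}⁻¹ Φ(e) γ_e`, which need not die in the quotient;
  -- retracting onto loops beforehand makes it descend.
  let f : 𝕏.FundTree τ →* 𝕐.FundTree σ :=
    QuotientGroup.lift _ ((𝕐.toFundTree σ).comp (Ψ.bassMap.comp hp.retraction)) fun x hx => by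
      have : hp.retraction x = 1 := hp.normalClosure_le_ker hx
      change 𝕐.toFundTree σ (Ψ.bassMap (hp.retraction x)) = 1
      rw [this, map_one, map_one]
  have hf : ∀ x ∈ 𝕏.FundVertex v₀, f (𝕏.toFundTree τ x) = 𝕐.toFundTree σ (Ψ.bassMap x) :=
    fun x hx => by
      change 𝕐.toFundTree σ (Ψ.bassMap (hp.retraction x)) = _
      rw [hp.retraction_of_mem hx]
  refine ⟨MulEquiv.ofBijective f ⟨?_, fun y => ?_⟩, hf⟩
  · rw [injective_iff_map_eq_one]
    intro x h
    obtain ⟨x, rfl⟩ := QuotientGroup.mk'_surjective _ x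
    change f (𝕏.toFundTree τ x) = 1 at h
    change 𝕏.toFundTree τ x = 1
    rw [← hp.toFundTree_retraction] at h ⊢
    rw [hf _ (hp.retraction_mem x)] at h
    have h1 := hq.eq_one_of_toFundTree_eq_one
      (Ψ.isPathElement_bassMap (hp.retraction_mem x)) h
    rw [← map_one Ψ.bassMap] at h1
    rw [Ψ.bassMap_injective h1, map_one]
  · obtain ⟨y, rfl⟩ := QuotientGroup.mk'_surjective _ y
    obtain ⟨x, hx, hxy⟩ := Ψ.exists_bassMap_eq (hq.retraction_mem y) v₀ v₀ rfl rfl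
    refine ⟨𝕏.toFundTree τ x, ?_⟩
    rw [hf x hx, hxy]
    exact hq.toFundTree_retraction y

/-- Multiplying the elements `γ_e` by elements of centralizers of edge groups. -/
theorem IsoOver.exists_twist (Ψ : IsoOver Φ 𝕏 𝕐) {G : Type*} [CommGroup G] (δ : 𝕐.Bass →* G)
    (ζ : Y.E → G)
    (hζ : ∀ e, ∃ z ∈ Subgroup.centralizer ((𝕐.inc e rfl rfl).range : Set (𝕐.VG (Y.t e))),
      δ (𝕐.vert _ z) = ζ e) :
    ∃ Ψ' : IsoOver Φ 𝕏 𝕐, Ψ'.onV = Ψ.onV ∧ ∀ e, δ (Ψ'.bassMap (𝕏.edge e)) =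
      δ (Ψ.bassMap (𝕏.edge e)) * (ζ (Φ.onE e) / ζ (Y.bar (Φ.onE e))) := by
  -- The centralizing element is moved from the group at `t(Φ e)` to the group at `Φ(t e)`.
  have hz : ∀ e, ∃ z : 𝕐.VG (Φ.onV (X.t e)),
      (∀ g, 𝕐.inc (Φ.onE e) (Φ.und_onE e) (Φ.map_t e) g * z =
        z * 𝕐.inc (Φ.onE e) (Φ.und_onE e) (Φ.map_t e) g) ∧
      δ (𝕐.vert _ z) = ζ (Φ.onE e) := by
    intro e
    have key : ∀ w (h : Y.t (Φ.onE e) = w), ∃ z : 𝕐.VG w,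
        (∀ g, 𝕐.inc (Φ.onE e) rfl h g * z = z * 𝕐.inc (Φ.onE e) rfl h g) ∧
          δ (𝕐.vert _ z) = ζ (Φ.onE e) := by
      rintro _ rfl
      obtain ⟨z, hz, h⟩ := hζ (Φ.onE e)
      exact ⟨z, fun g => Subgroup.mem_centralizer_iff.1 hz _ ⟨g, rfl⟩, h⟩
    exact key _ (Φ.map_t e)
  choose z hzc hzδ using hz
  let Ψ' : IsoOver Φ 𝕏 𝕐 :=
    { Ψ with
      γ := fun e => z e * Ψ.γ e
      comm := fun e g => by
        have : (z e)⁻¹ * 𝕐.inc (Φ.onE e) (Φ.und_onE e) (Φ.map_t e) (Ψ.onE (X.und e) g) * z e =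
            𝕐.inc (Φ.onE e) (Φ.und_onE e) (Φ.map_t e) (Ψ.onE (X.und e) g) := by
          rw [mul_assoc, hzc, inv_mul_cancel_left]
        rw [Ψ.comm]
        nth_rw 1 [← this]
        group }
  refine ⟨Ψ', rfl, fun e => ?_⟩
  rw [bassMap_edge, bassMap_edge]
  simp only [Ψ', map_mul, map_inv, hzδ, Φ.map_bar]
  have aux : ∀ a b c z w : G, (w * a)⁻¹ * b * (z * c) = a⁻¹ * b * c * (z / w) := by
    intro a b c z w
    simp only [div_eq_mul_inv, mul_inv, mul_comm, mul_left_comm, mul_assoc]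
  exact aux _ _ _ _ _

end GraphOfGroups

/-! ### Heights of induced isomorphisms and the Diophantine system. -/

section

open GraphOfGroups

variable {F₁ F₂ : Type*} [Group F₁] [Group F₂] {φ₁ : MulAut F₁} {φ₂ : MulAut F₂}
  {X Y : SerreGraph} {𝕏 : GraphOfGroups X} {𝕐 : GraphOfGroups Y} {ΦX : X.Iso Y}
  {τ : Set X.E} {σ : Set Y.E} {θ₁ : 𝕏.FundTree τ ≃* Suspension φ₁}
  {θ₂ : 𝕐.FundTree σ ≃* Suspension φ₂}

theorem treeHeight_surjective (θ₁ : 𝕏.FundTree τ ≃* Suspension φ₁) :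
    Function.Surjective (treeHeight 𝕏 θ₁) :=
  SemidirectProduct.rightHom_surjective.comp θ₁.surjective

/-- Conjugating by `p v` turns a vertex element into a loop at `v₀` without changing heights. -/
theorem fiberOrientationPreserving_onV {v₀ : X.V} {p : X.V → 𝕏.Bass}
    (hp : 𝕏.IsTreeFrame τ v₀ p) (Ψ : IsoOver ΦX 𝕏 𝕐)
    (h : ∀ x ∈ 𝕏.FundVertex v₀, bassHeight 𝕐 θ₂ (Ψ.bassMap x) = bassHeight 𝕏 θ₁ x) (v : X.V) :
    FiberOrientationPreserving (vertHeight 𝕏 θ₁ v) (vertHeight 𝕐 θ₂ (ΦX.onV v)) (Ψ.onV v) := by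
  refine fiberOrientationPreserving_of_height_eq fun g => ?_
  have := h (p v * 𝕏.vert v g * (p v)⁻¹)
    (((hp.path v).mul 𝕏 (.vertex v g)).mul 𝕏 ((hp.path v).inv 𝕏))
  simp only [map_mul, map_inv, mul_inv_cancel_comm, IsoOver.bassMap_vert] at this
  exact this

theorem InducedBy.bassHeight_eq {v₀ : X.V} {Θ : 𝕏.FundTree τ ≃* 𝕐.FundTree σ}
    {Ψ : IsoOver ΦX 𝕏 𝕐} (hΘ : InducedBy v₀ Θ Ψ)
    (h : FiberOrientationPreserving (treeHeight 𝕏 θ₁) (treeHeight 𝕐 θ₂) Θ) {x : 𝕏.Bass}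
    (hx : x ∈ 𝕏.FundVertex v₀) : bassHeight 𝕐 θ₂ (Ψ.bassMap x) = bassHeight 𝕏 θ₁ x := by
  obtain ⟨g, hg⟩ := hΘ
  have h1 := h.height_eq (treeHeight_surjective θ₁) (treeHeight_surjective θ₂) (𝕏.toFundTree τ x)
  rw [hg x hx, map_mul, map_mul, map_inv, mul_right_comm, inv_mul_cancel, one_mul] at h1
  exact h1

/-- The left-hand side of the Diophantine system, as a function of the Bass group. -/
noncomputable def systemHom (θ₂ : 𝕐.FundTree σ ≃* Suspension φ₂) {P : Set Y.E} {S : ∀ e, Set (𝕐.VG (Y.t e))}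
    (r : (Σ e : P, S e.1) →₀ ℤ) : 𝕐.Bass →* Multiplicative ℤ :=
  MonoidHom.mk' (fun x => Multiplicative.ofAdd (r.sum fun s a =>
    a * (𝕐.edgeCount s.1.1 x).toAdd * (vertHeight 𝕐 θ₂ (Y.t s.1.1) s.2.1).toAdd)) fun x y => by
      rw [← ofAdd_add]
      simp only [Finsupp.sum, map_mul, toAdd_mul, mul_add, add_mul, Finset.sum_add_distrib]

/-- Twist at `e` by an element of height `∑ r_s δ(s)`, `s ∈ S e`. Both sides are homomorphisms on
the Bass group, so only vertex elements, where the twist does nothing, and single edges matter. -/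
theorem exists_twist_system (θ₂ : 𝕐.FundTree σ ≃* Suspension φ₂) {P : Set Y.E}
    {S : ∀ e, Set (𝕐.VG (Y.t e))}
    (hS : ∀ e ∈ P, S e ⊆
      Subgroup.centralizer ((𝕐.inc e rfl rfl).range : Set (𝕐.VG (Y.t e))))
    (r : (Σ e : P, S e.1) →₀ ℤ) (Ψ : IsoOver ΦX 𝕏 𝕐) :
    ∃ Ψ' : IsoOver ΦX 𝕏 𝕐, ∀ x, bassHeight 𝕐 θ₂ (Ψ'.bassMap x) =
      bassHeight 𝕐 θ₂ (Ψ.bassMap x) * systemHom θ₂ r (Ψ.bassMap x) := by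
  classical
  -- The prescribed height is trivial for `e` outside `P`.
  let ζ : Y.E → Multiplicative ℤ := fun e => ∏ s ∈ r.support,
    if s.1.1 = e then vertHeight 𝕐 θ₂ (Y.t s.1.1) s.2.1 ^ r s else 1
  obtain ⟨Ψ', hV, hE⟩ := Ψ.exists_twist (bassHeight 𝕐 θ₂) ζ (fun e => by
    suffices ζ e ∈ (Subgroup.centralizer ((𝕐.inc e rfl rfl).range : Set (𝕐.VG (Y.t e)))).map
        (vertHeight 𝕐 θ₂ (Y.t e)) from this
    refine Subgroup.prod_mem _ fun s _ => ?_
    split_ifs with hs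
    · obtain ⟨⟨e', he'⟩, s⟩ := s
      subst hs
      exact Subgroup.zpow_mem _ (Subgroup.mem_map_of_mem _ (hS _ he' s.2)) _
    · exact one_mem _)
  refine ⟨Ψ', fun x => ?_⟩
  have : (bassHeight 𝕐 θ₂).comp Ψ'.bassMap =
      ((bassHeight 𝕐 θ₂).comp Ψ.bassMap) * ((systemHom θ₂ r).comp Ψ.bassMap) := by
    have hv : ∀ v g, systemHom θ₂ r (𝕐.vert v g) = 1 := fun v g => by simp [systemHom]
    refine 𝕏.bassHom_ext (fun v g => ?_) fun e => ?_
    · simp [hV, hv]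
    · have h : systemHom θ₂ r (Ψ.bassMap (𝕏.edge e)) = systemHom θ₂ r (𝕐.edge (ΦX.onE e)) := by
        simp only [IsoOver.bassMap_edge, map_mul, map_inv, hv, inv_one, one_mul, mul_one]
      rw [MonoidHom.comp_apply, hE, MonoidHom.mul_apply, MonoidHom.comp_apply,
        MonoidHom.comp_apply, h]
      congr 1
      apply Multiplicative.toAdd.injective
      -- Term by term, the difference between the twists at `Φ(e)` and at its reverse carries the
      -- sign given by the edge count of `Φ(e)`.
      simp only [ζ, systemHom, MonoidHom.mk'_apply, toAdd_ofAdd, toAdd_div, toAdd_prod, Finsupp.sum,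
        toAdd_edgeCount_edge, ← Finset.sum_sub_distrib]
      refine Finset.sum_congr rfl fun s _ => ?_
      split_ifs <;> simp [mul_comm]
  exact DFunLike.congr_fun this x

theorem bassHeight_eq_of_generators {ι : Type*} (b : FreeGroupBasis ι F₁) {x : Option ι → 𝕏.Bass}
    (hxF : ∀ i, θ₁ (𝕏.toFundTree τ (x (some i))) = Suspension.fib φ₁ (b i))
    (hxt : θ₁ (𝕏.toFundTree τ (x none)) = Suspension.stable φ₁)
    {δ : 𝕏.FundTree τ →* Multiplicative ℤ}
    (hδ : ∀ j, (δ (𝕏.toFundTree τ (x j))).toAdd = if j.isNone then 1 else 0) :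
    δ = treeHeight 𝕏 θ₁ := by
  suffices δ.comp θ₁.symm.toMonoidHom = Suspension.height φ₁ by
    rw [treeHeight, ← this]
    ext; simp
  refine SemidirectProduct.hom_ext (b.ext_hom _ _ fun i => ?_) (MonoidHom.ext_mint ?_)
  · have : δ (𝕏.toFundTree τ (x (some i))) = 1 := Multiplicative.toAdd.injective (hδ (some i))
    rw [← θ₁.symm_apply_apply (𝕏.toFundTree τ _), hxF] at this
    simpa [Suspension.height, Suspension.fib, Suspension.stable] using this
  · have : δ (𝕏.toFundTree τ (x none)) = Multiplicative.ofAdd 1 :=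
      Multiplicative.toAdd.injective (hδ none)
    rw [← θ₁.symm_apply_apply (𝕏.toFundTree τ _), hxt] at this
    simpa [Suspension.height, Suspension.fib, Suspension.stable] using this

end

/-! ### Replacing vertex isomorphisms by members of the lists. -/

/-- Each is a power of the other, and positivity of the heights forces both exponents to be 1. -/
theorem eq_of_zpowers_eq_top {A : Type*} [Group A] (δ : A →* Multiplicative ℤ) {c d : A}
    (hc : Subgroup.zpowers c = ⊤) (hd : Subgroup.zpowers d = ⊤) (hδc : 0 < (δ c).toAdd)
    (hδd : 0 < (δ d).toAdd) : c = d := by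
  obtain ⟨k, hk⟩ := Subgroup.mem_zpowers_iff.1 (hc ▸ Subgroup.mem_top d : d ∈ Subgroup.zpowers c)
  obtain ⟨l, hl⟩ := Subgroup.mem_zpowers_iff.1 (hd ▸ Subgroup.mem_top c : c ∈ Subgroup.zpowers d)
  have h1 : k * (δ c).toAdd = (δ d).toAdd := by rw [← hk, map_zpow, toAdd_zpow, smul_eq_mul]
  have h2 : l * (δ d).toAdd = (δ c).toAdd := by rw [← hl, map_zpow, toAdd_zpow, smul_eq_mul]
  have hk0 : 0 < k := pos_of_mul_pos_left (h1 ▸ hδd) hδc.le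
  have hkl : l * k = 1 := by
    refine mul_right_cancel₀ hδc.ne' ?_
    rw [mul_assoc, h1, h2, one_mul]
  rw [← hk, Int.eq_one_of_mul_eq_one_left hk0.le hkl, zpow_one]

/-- If centralizers lift from `Γ ⧸ K`, then a conjugator modulo `K` between conjugate elements is
congruent modulo `K` to a conjugator. -/
theorem exists_conj_congr {Γ : Type*} [Group Γ] (K : Subgroup Γ) [K.Normal] {p a γ z : Γ}
    (hz : z ∈ K) (ha : γ⁻¹ * p * γ = a * z) (hconj : IsConj a p)
    (hcent : Subgroup.centralizer {QuotientGroup.mk' K p} =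
      (Subgroup.centralizer {p}).map (QuotientGroup.mk' K)) :
    ∃ γ', a = γ'⁻¹ * p * γ' ∧ γ⁻¹ * γ' ∈ K := by
  obtain ⟨c, hc⟩ := isConj_iff.1 hconj
  have hz' : QuotientGroup.mk' K z = 1 := (QuotientGroup.eq_one_iff z).2 hz
  have h1 := congrArg (QuotientGroup.mk' K) ha
  have h2 := congrArg (QuotientGroup.mk' K) hc
  simp only [map_mul, map_inv, hz', mul_one] at h1 h2
  -- Modulo `K`, both `γ` and the exact conjugator `c` take `p` to `a`, so they differ by an element
  -- centralizing `p`. A lift `k` of it that truly centralizes `p` gives `γ' = k * c`.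
  have hmem : QuotientGroup.mk' K (γ * c⁻¹) ∈
      Subgroup.centralizer {QuotientGroup.mk' K p} := by
    rw [Subgroup.mem_centralizer_singleton_iff, map_mul, map_inv]
    rw [mul_assoc, inv_mul_eq_iff_eq_mul] at h1
    rw [mul_assoc, ← eq_inv_mul_iff_mul_eq] at h2
    rw [← mul_assoc, h1, mul_assoc, mul_assoc, ← h2]
  rw [hcent] at hmem
  obtain ⟨k, hk, hkγ⟩ := hmem
  rw [SetLike.mem_coe, Subgroup.mem_centralizer_singleton_iff] at hk
  refine ⟨k * c, ?_, ?_⟩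
  · have : k⁻¹ * p * k = p := by rw [mul_assoc, ← hk, inv_mul_cancel_left]
    rw [mul_inv_rev, mul_assoc c⁻¹, mul_assoc c⁻¹, ← mul_assoc _ k c, this, ← hc]
    group
  · rw [← QuotientGroup.eq_one_iff]
    change QuotientGroup.mk' K (γ⁻¹ * (k * c)) = 1
    rw [map_mul, map_mul, hkγ, ← map_mul, ← map_mul]
    simp

namespace GraphOfGroups

variable {X Y : SerreGraph} {𝕏 : GraphOfGroups X} {𝕐 : GraphOfGroups Y} {Φ : X.Iso Y}

/-- Vertex elements have count zero, so only `Φ` is seen. -/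
theorem IsoOver.edgeCount_bassMap_eq (Ψ Ψ' : IsoOver Φ 𝕏 𝕐) (e₀ : Y.E) (x : 𝕏.Bass) :
    𝕐.edgeCount e₀ (Ψ.bassMap x) = 𝕐.edgeCount e₀ (Ψ'.bassMap x) := by
  have : (𝕐.edgeCount e₀).comp Ψ.bassMap = (𝕐.edgeCount e₀).comp Ψ'.bassMap :=
    𝕏.bassHom_ext (fun v g => by simp) fun e => by simp [bassMap_edge]
  exact DFunLike.congr_fun this x

/-- An edge contributes `η(o e)⁻¹ η(t e)`, which telescopes along a path and vanishes on loops. -/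
theorem IsoOver.map_bassMap_eq_of_path (Ψ Ψ' : IsoOver Φ 𝕏 𝕐) {G : Type*} [CommGroup G]
    (δ : 𝕐.Bass →* G) (η : X.V → G)
    (hV : ∀ v g, δ (𝕐.vert _ (Ψ'.onV v g)) = δ (𝕐.vert _ (Ψ.onV v g)))
    (hγ : ∀ e, δ (𝕐.vert _ (Ψ'.γ e)) = δ (𝕐.vert _ (Ψ.γ e)) * η (X.t e))
    {v w : X.V} {x : 𝕏.Bass} (hx : 𝕏.IsPathElement v w x) :
    η v * δ (Ψ'.bassMap x) = δ (Ψ.bassMap x) * η w := by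
  induction hx with
  | vertex v g => rw [bassMap_vert, bassMap_vert, hV, mul_comm]
  | cons e g w x _ ih =>
    simp only [map_mul, map_inv, bassMap_vert, bassMap_edge, hV, hγ]
    have aux : ∀ a b c d f h i j k : G, c * f = h * k →
        j * (a * ((d * j)⁻¹ * b * (i * c)) * f) = a * (d⁻¹ * b * i) * h * k := by
      intro a b c d f h i j k hk
      calc _ = a * d⁻¹ * b * i * (c * f) * (j * j⁻¹) := by
            simp only [mul_inv, mul_comm, mul_left_comm, mul_assoc]
        _ = _ := by
            rw [hk, mul_inv_cancel, mul_one]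
            simp only [mul_assoc]
    exact aux _ _ _ _ _ _ _ _ _ ih

end GraphOfGroups

section

open GraphOfGroups

variable {F₁ F₂ : Type*} [Group F₁] [Group F₂] {φ₁ : MulAut F₁} {φ₂ : MulAut F₂}
  {X Y : SerreGraph} {𝕏 : GraphOfGroups X} {𝕐 : GraphOfGroups Y} {ΦX : X.Iso Y}
  {τ : Set X.E} {σ : Set Y.E} {θ₁ : 𝕏.FundTree τ ≃* Suspension φ₁}
  {θ₂ : 𝕐.FundTree σ ≃* Suspension φ₂} {c₁ : ∀ u, 𝕏.EG u} {c₂ : ∀ u, 𝕐.EG u}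

theorem inc_cyclicMarking_nonneg (hc₂ : IsCyclicMarking 𝕐 θ₂ c₂) (e : Y.E) {u : Y.UEdge} {w : Y.V}
    (hu : Y.und e = u) (hw : Y.t e = w) :
    0 ≤ (vertHeight 𝕐 θ₂ w (𝕐.inc e hu hw (c₂ u))).toAdd := by
  subst hu hw
  exact hc₂.2 e

/-- By transversality both generators have positive height, which excludes the inverse generator. -/
theorem GraphOfGroups.IsoOver.map_cyclicMarking (hc₁ : IsCyclicMarking 𝕏 θ₁ c₁) (hc₂ : IsCyclicMarking 𝕐 θ₂ c₂)
    (Ψ : IsoOver ΦX 𝕏 𝕐) (e : X.E)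
    (hΨ : FiberOrientationPreserving (vertHeight 𝕏 θ₁ (X.t e)) (vertHeight 𝕐 θ₂ _)
      (Ψ.onV (X.t e)))
    (h₁ : IsTransversePeripheral (vertHeight 𝕏 θ₁ (X.t e)) (peripheral 𝕏 c₁ (X.t e)))
    (h₂ : IsTransversePeripheral (vertHeight 𝕐 θ₂ _) (peripheralOver ΦX 𝕐 c₂ (X.t e))) :
    Ψ.onE (X.und e) (c₁ (X.und e)) = c₂ (ΦX.onU (X.und e)) := by
  have hp₁ := lt_of_le_of_ne (hc₁.2 e) (h₁ ⟨e, rfl⟩).symm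
  have hp₂ := lt_of_le_of_ne (inc_cyclicMarking_nonneg hc₂ (ΦX.onE e) (ΦX.und_onE e) (ΦX.map_t e))
    (h₂ ⟨e, rfl⟩).symm
  have hp₃ := hΨ.height_pos hp₁
  rw [Ψ.comm, MonoidHom.map_mul, MonoidHom.map_mul, MonoidHom.map_inv, mul_right_comm,
    inv_mul_cancel, one_mul] at hp₃
  refine eq_of_zpowers_eq_top ((vertHeight 𝕐 θ₂ _).comp
    (𝕐.inc (ΦX.onE e) (ΦX.und_onE e) (ΦX.map_t e))) ?_ (hc₂.1 _) hp₃ hp₂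
  have := MonoidHom.map_zpowers (Ψ.onE (X.und e)).toMonoidHom (c₁ (X.und e))
  rw [hc₁.1, Subgroup.map_top_of_surjective _ (Ψ.onE (X.und e)).surjective] at this
  exact this.symm

theorem exists_isoOver_mem_list {m : ℕ} (hc₁ : IsCyclicMarking 𝕏 θ₁ c₁)
    (hc₂ : IsCyclicMarking 𝕐 θ₂ c₂)
    {L : ∀ v, List (𝕏.VG v ≃* 𝕐.VG (ΦX.onV v))}
    (hL : ∀ v, IsCompleteList (vertHeight 𝕏 θ₁ v) (vertHeight 𝕐 θ₂ (ΦX.onV v))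
      (peripheral 𝕏 c₁ v) (peripheralOver ΦX 𝕐 c₂ v) m (L v))
    (Ψ : IsoOver ΦX 𝕏 𝕐)
    (hΨ : ∀ v, FiberOrientationPreserving (vertHeight 𝕏 θ₁ v) (vertHeight 𝕐 θ₂ (ΦX.onV v))
      (Ψ.onV v)) :
    ∃ Ψ' : IsoOver ΦX 𝕏 𝕐, (∀ v, Ψ'.onV v ∈ L v) ∧
      ∀ v, ∀ x ∈ 𝕏.FundVertex v,
        bassHeight 𝕐 θ₂ (Ψ'.bassMap x) = bassHeight 𝕐 θ₂ (Ψ.bassMap x) := by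
  have hc : ∀ e, Ψ.onE (X.und e) (c₁ (X.und e)) = c₂ (ΦX.onU (X.und e)) := fun e =>
    Ψ.map_cyclicMarking hc₁ hc₂ e (hΨ _) (hL _).transverse₁ (hL _).transverse₂
  have hcomm : ∀ e, Ψ.onV (X.t e) (𝕏.inc e rfl rfl (c₁ (X.und e))) = (Ψ.γ e)⁻¹ *
      𝕐.inc (ΦX.onE e) (ΦX.und_onE e) (ΦX.map_t e) (c₂ (ΦX.onU (X.und e))) * Ψ.γ e := fun e => by
    rw [Ψ.comm, hc]
  have hpres : ∀ v, PreservesSuspensionStructure (vertHeight 𝕏 θ₁ v)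
      (vertHeight 𝕐 θ₂ (ΦX.onV v)) (peripheral 𝕏 c₁ v) (peripheralOver ΦX 𝕐 c₂ v) (Ψ.onV v) := by
    refine fun v => ⟨hΨ v, ?_⟩
    rintro ⟨e, rfl⟩
    refine isConj_iff.2 ⟨Ψ.γ e, ?_⟩
    refine (congrArg (fun z => Ψ.γ e * z * (Ψ.γ e)⁻¹) (hcomm e)).trans ?_
    simp only [mul_assoc, mul_inv_cancel, mul_one, mul_inv_cancel_left]
    rfl
  choose φ hφL g z hzK hz using fun v => (hL v).complete (Ψ.onV v) (hpres v)
  have hker : ∀ v, ∀ k ∈ fillingKernel (vertHeight 𝕐 θ₂ (ΦX.onV v)) m,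
      vertHeight 𝕐 θ₂ (ΦX.onV v) k = 1 := fun v k hk => fillingKernel_le_ker _ _ hk
  -- The old data give `γ_e g_{t(e)}` as a conjugator modulo `K_m` for the list element; it is
  -- corrected to an exact one.
  have hγ : ∀ e, ∃ γ' : 𝕐.VG (ΦX.onV (X.t e)), φ (X.t e) (𝕏.inc e rfl rfl (c₁ (X.und e))) =
      γ'⁻¹ * 𝕐.inc (ΦX.onE e) (ΦX.und_onE e) (ΦX.map_t e) (c₂ (ΦX.onU (X.und e))) * γ' ∧
      (Ψ.γ e * g (X.t e))⁻¹ * γ' ∈ fillingKernel (vertHeight 𝕐 θ₂ (ΦX.onV (X.t e))) m := by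
    intro e
    refine exists_conj_congr _ (hzK (X.t e) (𝕏.inc e rfl rfl (c₁ (X.und e)))) ?_
      (((hL _).preserves _ (hφL _)).2 ⟨e, rfl⟩) ((hL _).centralizer ⟨e, rfl⟩)
    rw [← hz, hcomm]
    group
  choose γ' hγ' hγK using hγ
  let Ψ' : IsoOver ΦX 𝕏 𝕐 :=
    { onV := φ
      onE := Ψ.onE
      γ := γ'
      comm := fun e k => by
        -- The edge group is cyclic, so compatibility on the marked generator suffices.
        obtain ⟨n, rfl⟩ := Subgroup.mem_zpowers_iff.1
          (hc₁.1 (X.und e) ▸ Subgroup.mem_top k : k ∈ Subgroup.zpowers (c₁ (X.und e)))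
        have h := conj_zpow (i := n) (a := (γ' e)⁻¹)
          (b := 𝕐.inc (ΦX.onE e) (ΦX.und_onE e) (ΦX.map_t e) (c₂ (ΦX.onU (X.und e))))
        rw [inv_inv] at h
        simp only [map_zpow, hc, hγ', h] }
  refine ⟨Ψ', hφL, fun v x hx => ?_⟩
  have h := IsoOver.map_bassMap_eq_of_path Ψ Ψ' (bassHeight 𝕐 θ₂)
    (fun v => vertHeight 𝕐 θ₂ (ΦX.onV v) (g v)) (fun v k => ?_) (fun e => ?_) hx
  · rw [mul_comm] at h
    exact mul_right_cancel h
  · have := congrArg (vertHeight 𝕐 θ₂ (ΦX.onV v)) (hz v k)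
    rw [map_mul, map_mul, map_mul, hker v _ (hzK v k), mul_one, map_inv, mul_right_comm,
      inv_mul_cancel, one_mul] at this
    exact this.symm
  · have := hker _ _ (hγK e)
    rw [map_mul, map_inv, inv_mul_eq_one, map_mul] at this
    exact this.symm

end

/-! ### The equivalence. -/

theorem mainTheorem11
    {F : Type*} [Group F] {ι : Type*} [Finite ι] (b : FreeGroupBasis ι F)
    (φ₁ φ₂ : MulAut F)
    {X₁ X₂ : SerreGraph} (𝕏₁ : GraphOfGroups X₁) (𝕏₂ : GraphOfGroups X₂)
    (ΦX : X₁.Iso X₂)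
    (τ : Set X₁.E) (hτ : X₁.IsMaximalSubtree τ)
    (θ₁ : 𝕏₁.FundTree τ ≃* Suspension φ₁)
    (θ₂ : 𝕏₂.FundTree (ΦX.onE '' τ) ≃* Suspension φ₂)
    (c₁ : ∀ u, 𝕏₁.EG u) (hc₁ : IsCyclicMarking 𝕏₁ θ₁ c₁)
    (c₂ : ∀ u, 𝕏₂.EG u) (hc₂ : IsCyclicMarking 𝕏₂ θ₂ c₂)
    (m : ℕ)
    (L : ∀ v, List (𝕏₁.VG v ≃* 𝕏₂.VG (ΦX.onV v)))
    (hL : ∀ v, IsCompleteList (vertHeight 𝕏₁ θ₁ v) (vertHeight 𝕏₂ θ₂ (ΦX.onV v))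
      (peripheral 𝕏₁ c₁ v) (peripheralOver ΦX 𝕏₂ c₂ v) m (L v))
    (P : Set X₂.E) (hP : X₂.IsOrientation P)
    (S : ∀ e, Set (𝕏₂.VG (X₂.t e)))
    (hS : ∀ e ∈ P, Subgroup.closure (S e) =
      Subgroup.centralizer ((𝕏₂.inc e rfl rfl).range : Set (𝕏₂.VG (X₂.t e))))
    (v₀ : X₁.V) (x : Option ι → 𝕏₁.Bass) (hx : ∀ j, x j ∈ 𝕏₁.FundVertex v₀)
    (hxF : ∀ i, θ₁ (𝕏₁.toFundTree τ (x (some i))) = Suspension.fib φ₁ (b i))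
    (hxt : θ₁ (𝕏₁.toFundTree τ (x none)) = Suspension.stable φ₁) :
    List.TFAE [
      ∃ Φ : 𝕏₁.FundTree τ ≃* 𝕏₂.FundTree (ΦX.onE '' τ),
        FiberOrientationPreserving (treeHeight 𝕏₁ θ₁) (treeHeight 𝕏₂ θ₂) Φ ∧
        ∃ Ψ : GraphOfGroups.IsoOver ΦX 𝕏₁ 𝕏₂, InducedBy v₀ Φ Ψ,
      ∃ Φ₀ : GraphOfGroups.IsoOver ΦX 𝕏₁ 𝕏₂,
        (∀ v, FiberOrientationPreserving (vertHeight 𝕏₁ θ₁ v) (vertHeight 𝕏₂ θ₂ (ΦX.onV v))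
          (Φ₀.onV v)) ∧
        SystemSolvable 𝕏₂ θ₂ P S fun j => Φ₀.bassMap (x j),
      ∃ Φ₀ : GraphOfGroups.IsoOver ΦX 𝕏₁ 𝕏₂,
        (∀ v, Φ₀.onV v ∈ L v) ∧
        SystemSolvable 𝕏₂ θ₂ P S fun j => Φ₀.bassMap (x j)] := by
  have hsys : ∀ Ψ Ψ' : GraphOfGroups.IsoOver ΦX 𝕏₁ 𝕏₂,
      (∀ y ∈ 𝕏₁.FundVertex v₀, bassHeight 𝕏₂ θ₂ (Ψ'.bassMap y) =
        bassHeight 𝕏₂ θ₂ (Ψ.bassMap y)) →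
      (SystemSolvable 𝕏₂ θ₂ P S fun j => Ψ.bassMap (x j)) →
      SystemSolvable 𝕏₂ θ₂ P S fun j => Ψ'.bassMap (x j) := by
    rintro Ψ Ψ' h ⟨r, hr⟩
    refine ⟨r, fun j => ?_⟩
    simp only [h _ (hx j), Ψ'.edgeCount_bassMap_eq Ψ]
    exact hr j
  have hx₁ : ∀ j, (bassHeight 𝕏₁ θ₁ (x j)).toAdd = if j.isNone then 1 else 0 := by
    rintro (_ | i)
    · change (Suspension.height φ₁ (θ₁ (𝕏₁.toFundTree τ (x none)))).toAdd = _
      rw [hxt]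
      rfl
    · change (Suspension.height φ₁ (θ₁ (𝕏₁.toFundTree τ (x (some i))))).toAdd = _
      rw [hxF]
      rfl
  obtain ⟨p, hp⟩ := 𝕏₁.exists_isTreeFrame hτ v₀
  obtain ⟨q, hq⟩ := GraphOfGroups.exists_isTreeFrame_map ΦX 𝕏₂ hτ v₀
  tfae_have 1 → 2 := by
    rintro ⟨Θ, hΘ, Ψ, hΨ⟩
    have h : ∀ y ∈ 𝕏₁.FundVertex v₀, bassHeight 𝕏₂ θ₂ (Ψ.bassMap y) = bassHeight 𝕏₁ θ₁ y :=
      fun y hy => hΨ.bassHeight_eq hΘ hy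
    refine ⟨Ψ, fiberOrientationPreserving_onV hp Ψ h, 0, fun j => ?_⟩
    rw [Finsupp.sum_zero_index, h _ (hx j), hx₁, neg_add_cancel]
  tfae_have 2 → 3 := by
    rintro ⟨Ψ, hΨ, hr⟩
    obtain ⟨Ψ', hΨ', h⟩ := exists_isoOver_mem_list hc₁ hc₂ hL Ψ hΨ
    exact ⟨Ψ', hΨ', hsys Ψ Ψ' (h v₀) hr⟩
  tfae_have 3 → 1 := by
    rintro ⟨Ψ, -, r, hr⟩
    obtain ⟨Ψ', hΨ'⟩ := exists_twist_system (P := P) (S := S) θ₂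
      (fun e he => (hS e he).symm ▸ Subgroup.subset_closure) r Ψ
    obtain ⟨Θ, hΘ⟩ := Ψ'.exists_fundTree_equiv hp hq
    -- Heights on the suspension are determined by the basis of the fiber and `t`, so they need to
    -- be compared only on the `x j`.
    refine ⟨Θ, fiberOrientationPreserving_of_height_eq (DFunLike.congr_fun
      (bassHeight_eq_of_generators b hxF hxt (δ := (treeHeight 𝕏₂ θ₂).comp Θ.toMonoidHom)
        fun j => ?_)), Ψ', 1, fun y hy => by rw [hΘ y hy, inv_one, one_mul, mul_one]⟩
    change (treeHeight 𝕏₂ θ₂ (Θ (𝕏₁.toFundTree τ (x j)))).toAdd = _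
    rw [hΘ _ (hx j)]
    change (bassHeight 𝕏₂ θ₂ (Ψ'.bassMap (x j))).toAdd = _
    rw [hΨ', toAdd_mul]
    have : (systemHom θ₂ r (Ψ.bassMap (x j))).toAdd = _ := hr j
    rw [this, add_neg_cancel_left]
  tfae_finish
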